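/- **Setting.** Let $X$ be an infinite dimensional separable real Banach space with a centred nondegenerate Gaussian measure $\gamma$ on its Borel sets. Let $\mathcal H$ be the closure of $X^*$ in $L^2(X,\gamma)$, let $R\hat h=\int_X x\,\hat h(x)\,d\gamma(x)$ for $\hat h\in\mathcal H$, and let $H=R(\mathcal H)\subset X$ be the Cameron–Martin space, with $[R\hat h,R\hat k]_H=\langle \hat h,\hat k\rangle_{L^2(X,\gamma)}$. Fix an orthonormal basis $(h_j)_{j\in\mathbb N}$ of $H$ with $\hat h_j\in X^*$ for every $j$. For $h\in H$ put $\partial_hf(x)=\lim_{t\to0}\frac{f(x+th)-f(x)}t$ and $\partial_h^*f=\partial_hf-f\,\hat h$. Let $\mathscr FC^1_b(X)$ be the space of functions $x\mapsto g(x_1^*(x),\dots,x_m^*(x))$ with $x_i^*\in X^*$ and $g\in C^1(\mathbb R^m)$, where $g$ and its derivatives are bounded. A function $u\in L^2(X,\gamma)$ belongs to $BV(X,\gamma)$ if there is an $H$-valued Borel measure $D_\gamma u$ of finite total variation such that $\int_X u\,\partial^*_{h_j}\varphi\,d\gamma=-\int_X\varphi\,d[h_j,D_\gamma u]_H$ for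 all $\varphi\in\mathscr FC^1_b(X)$ and all $j\in\mathbb N$. Then $|D_\gamma u|$ denotes the total variation measure of $D_\gamma u$. For $\Omega\subset X$ open, let $\mathrm{Lip}_0(\Omega,H)$ be the set of maps $\varphi:X\to H$ that are Lipschitz with respect to the norm of $X$ and vanish on $X\setminus\Omega$. The divergence $\operatorname{div}_\gamma\varphi$ is the function $g\in L^2(X,\gamma)$ such that $\int_X fg\,d\gamma=-\int_X[\nabla_Hf,\varphi]_H\,d\gamma$ for all $f\in\mathscr FC^1_b(X)$. For a function $w\in L^2(\Omega,\gamma)$ that is given only on $\Omega$, or is not in $BV(X,\gamma)$, put $$|D_\gamma w|(\Omega):=\sup\Bigl\{\int_\Omega w\,\operatorname{div}_\gamma\varphi\,d\gamma:\ \varphi\in\mathrm{Lip}_0(\Omega,H),\ |\varphi(x)|_H\le1\ \forall x\in X\Bigr\}\in[0,+\infty],$$ the supremum being taken over those $\varphi$ that have a divergence in $L^2(X,\gamma)$. **Corollary 2.4.** Let $u\in BV(X,\gamma)$ and let $\Omega\subset X$ be an open set such that $u_{|\Omega}\in L^2(\Omega,\gamma)$. Let $(u_n)_n$ be a sequence that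 converges to $u$ in $L^2(\Omega,\gamma)$. Then $$|D_\gamma u|(\Omega)\le\liminf_{n\to\infty}|D_\gamma u_n|(\Omega)$$ in each of the following two cases, where the left-hand side is always the total variation measure of $D_\gamma u$ evaluated at $\Omega$: 1. $u_n\in BV(X,\gamma)$ for every $n$, and $|D_\gamma u_n|(\Omega)$ is the total variation measure of $D_\gamma u_n$ evaluated at $\Omega$; 2. $u_n\in L^2(\Omega,\gamma)$ for every $n$, and $|D_\gamma u_n|(\Omega)$ is the supremum displayed above. -/

import Mathlib

open MeasureTheory ProbabilityTheory Filter Topology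
open scoped ENNReal NNReal

namespace WienerBV

noncomputable section

variable {X : Type*} [NormedAddCommGroup X] [NormedSpace ℝ X] [MeasurableSpace X] [BorelSpace X]

/-- `𝓗`, the closure of the dual `X*` in `L²(X, γ)`, with the inner product of `L²(X, γ)`.

The Cameron-Martin space `H ⊆ X` is the image of `𝓗` under the injective map `R` (`embed` below),
and its inner product is `[h, k]_H = ⟪ĥ, k̂⟫_{L²(γ)}` where `h = R ĥ`, `k = R k̂`. So `R` is an
isometric isomorphism of `𝓗` onto `H`; we represent a vector `h = R ĥ` of `H` by `ĥ`, and write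
`embed γ ĥ` for `h` seen as a point of `X`. -/
abbrev CameronMartin (γ : Measure X) : Type _ :=
  ↥(LinearMap.range (StrongDual.toLp (𝕜 := ℝ) γ 2).toLinearMap).topologicalClosure

/-- The map `R ĥ = ∫ x ĥ(x) dγ(x)` (a Bochner integral in `X`). -/
def embed (γ : Measure X) (h : CameronMartin γ) : X :=
  ∫ x, (h : Lp ℝ 2 γ) x • x ∂γ

/-- `γ` is a centred, nondegenerate Gaussian measure: every `L ∈ X*` has a Gaussian law with mean
zero, and this law has positive variance if `L ≠ 0` (the covariance operator is injective). -/
structure IsCentredNondegenerateGaussian (γ : Measure X) : Prop where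
  isGaussian : IsGaussian γ
  centred : ∀ L : StrongDual ℝ X, ∫ x, L x ∂γ = 0
  nondegenerate : ∀ L : StrongDual ℝ X, L ≠ 0 → 0 < ∫ x, (L x) ^ 2 ∂γ

/-- The orthonormal basis `(h_j)` of `H` lies in `Q(X*)`: each `ĥ_j` is (the class of) an element
of `X*`. -/
def BasisInDual (γ : Measure X) (b : HilbertBasis ℕ ℝ (CameronMartin γ)) : Prop :=
  ∀ j, ∃ L : StrongDual ℝ X, StrongDual.toLp γ 2 L = (b j : Lp ℝ 2 γ)

/-- The space `𝓕C¹_b(X)` of bounded, continuously differentiable cylindrical functions with bounded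
derivatives. -/
def IsCylindricalC1b (f : X → ℝ) : Prop :=
  ∃ (m : ℕ) (L : Fin m → StrongDual ℝ X) (g : (Fin m → ℝ) → ℝ),
    ContDiff ℝ 1 g ∧ (∃ C : ℝ, ∀ y, |g y| ≤ C) ∧ (∃ C : ℝ, ∀ y, ‖fderiv ℝ g y‖ ≤ C) ∧
      ∀ x, f x = g (fun i => L i x)

/-- `∂_h f(x) = lim_{t → 0} (f(x + t h) - f(x)) / t`. -/
def partialDeriv (γ : Measure X) (h : CameronMartin γ) (f : X → ℝ) (x : X) : ℝ :=
  lineDeriv ℝ f x (embed γ h)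

/-- `∂*_h f(x) = ∂_h f(x) - f(x) ĥ(x)`. -/
def adjointDeriv (γ : Measure X) (h : CameronMartin γ) (f : X → ℝ) (x : X) : ℝ :=
  partialDeriv γ h f x - f x * (h : Lp ℝ 2 γ) x

/-- The component `μ_h = [h, μ]_H` of an `H`-valued measure. -/
def component (γ : Measure X) (μ : VectorMeasure X (CameronMartin γ)) (h : CameronMartin γ) :
    SignedMeasure X :=
  μ.mapRange (innerSL ℝ h).toLinearMap.toAddMonoidHom (innerSL ℝ h).continuous

/-- `u ∈ BV(X, γ)` with `D_γ u = μ`: `u ∈ L²(X, γ)`, `μ` is an `H`-valued measure of finite total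
variation, and `∫ u ∂*_j φ dγ = - ∫ φ dμ_j` for all `φ ∈ 𝓕C¹_b(X)` and all `j`. -/
structure IsBVWithGradient (γ : Measure X) (b : HilbertBasis ℕ ℝ (CameronMartin γ)) (u : X → ℝ)
    (μ : VectorMeasure X (CameronMartin γ)) : Prop where
  memLp : MemLp u 2 γ
  variation_lt_top : μ.variation Set.univ < ∞
  integral_by_parts : ∀ φ : X → ℝ, IsCylindricalC1b φ → ∀ j : ℕ,
    ∫ x, u x * adjointDeriv γ (b j) φ x ∂γ = - ∫ᵛ x, φ x ∂•(component γ μ (b j))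

/-- `Lip₀(Ω, H)`: the maps `X → H` that are Lipschitz continuous with respect to the norm of `X`
and vanish outside `Ω`. -/
def IsLip0 (γ : Measure X) (Ω : Set X) (φ : X → CameronMartin γ) : Prop :=
  (∃ K : ℝ≥0, LipschitzWith K φ) ∧ ∀ x, x ∉ Ω → φ x = 0

/-- `g = div_γ φ` in `L²(X, γ)`, where `-div_γ` is the adjoint of the gradient `∇_H`:
`∫ f g dγ = - ∫ [∇_H f, φ]_H dγ` for all `f ∈ 𝓕C¹_b(X)`.
Here `[∇_H f(x), φ(x)]_H = ∂_{φ(x)} f(x)`, which is the defining property of `∇_H f(x) ∈ H`. -/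
def IsDivergence (γ : Measure X) (φ : X → CameronMartin γ) (g : X → ℝ) : Prop :=
  MemLp g 2 γ ∧ ∀ f : X → ℝ, IsCylindricalC1b f →
    ∫ x, f x * g x ∂γ = - ∫ x, partialDeriv γ (φ x) f x ∂γ

/-- The variation in `Ω` of a function `w ∈ L²(Ω, γ)`, with values in `[0, ∞]`:
`sup {∫_Ω w div_γ φ dγ : φ ∈ Lip₀(Ω, H), ‖φ‖_∞ ≤ 1}`. -/
def variationOn (γ : Measure X) (Ω : Set X) (w : X → ℝ) : ℝ≥0∞ :=
  ⨆ (φ : X → CameronMartin γ) (g : X → ℝ) (_ : IsLip0 γ Ω φ) (_ : ∀ x, ‖φ x‖ ≤ 1)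
    (_ : IsDivergence γ φ g), ENNReal.ofReal (∫ x in Ω, w x * g x ∂γ)

end

end WienerBV

/-! The proof is by duality. For every `c < |D_γ u|(Ω)` a single test field is built whose
divergence `g ∈ L²(γ)` vanishes a.e. off `Ω` and satisfies `∫ u g dγ > c`. Convergence in `L²(Ω, γ)`
gives `∫_Ω v_n g dγ → ∫ u g dγ`, so `c` is eventually a lower bound for the variations of `v_n`, in
either sense of variation.

The field is a finite sum of Lipschitz bumps around disjoint compact subsets of `Ω`, times
directions of norm at most 1 in the span of the basis (`exists_bumps`). The difficulty is that such
bumps are not cylindrical, while `BV` is tested only against cylindrical functions.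
`lipschitz_induction` reaches bounded Lipschitz functions from cylindrical ones by pointwise limits
with uniform bounds, and weak compactness in `L²(γ)` carries the divergence through these limits
(`exists_isWeakDivergence`). The divergence so obtained pairs with every weakly differentiable
function at once: with `BV` functions, with cylindrical ones, and with products of a bump and a
cylindrical function. The products yield locality (`IsWeakDivergence.ae_eq_zero`), which localises
the integrals to `Ω`. -/

namespace WienerBV

/-! ### Gaussian integration by parts along Cameron–Martin directions. -/

section GaussianIntegrationByParts

section Stein

lemma hasDerivAt_gaussianPDFReal_zero {v : ℝ≥0} (hv : v ≠ 0) (x : ℝ) :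
    HasDerivAt (gaussianPDFReal 0 v) (-(x / v) * gaussianPDFReal 0 v x) x := by
  have hv' : (v : ℝ) ≠ 0 := by exact_mod_cast hv
  have h1 : HasDerivAt (fun y : ℝ => -(y - 0) ^ 2 / (2 * v)) (-(x / v)) x := by
    have := ((((hasDerivAt_id x).sub_const 0).pow 2).neg).div_const (2 * (v : ℝ))
    refine this.congr_deriv ?_
    simp
    field_simp
  have h2 := (h1.exp).const_mul ((√(2 * Real.pi * v))⁻¹)
  rw [gaussianPDFReal_def]
  refine h2.congr_deriv ?_
  ring

/-- Stein's identity for a centred Gaussian law on the line. -/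
lemma integral_mul_id_gaussianReal {v : ℝ≥0} (hv : v ≠ 0) {f f' : ℝ → ℝ}
    (hf : ∀ s, HasDerivAt f (f' s) s) (hf' : Continuous f') {C C' : ℝ}
    (hC : ∀ s, |f s| ≤ C) (hC' : ∀ s, |f' s| ≤ C') :
    ∫ s, f s * s ∂(gaussianReal 0 v) = v * ∫ s, f' s ∂(gaussianReal 0 v) := by
  have hv' : (v : ℝ) ≠ 0 := by exact_mod_cast hv
  have hfc : Continuous f := continuous_iff_continuousAt.2 fun s => (hf s).continuousAt
  have hpi := integrable_gaussianPDFReal 0 v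
  have hid : Integrable (fun x : ℝ => gaussianPDFReal 0 v x * x) := by
    have h := (memLp_id_gaussianReal (μ := 0) (v := v) 1).integrable (by simp)
    rw [gaussianReal_of_var_ne_zero 0 hv,
      integrable_withDensity_iff_integrable_smul' (measurable_gaussianPDF 0 v)
        (ae_of_all _ fun x => gaussianPDF_lt_top)] at h
    simpa [toReal_gaussianPDF] using h
  have e1 : Integrable (f * fun x => -(x / v) * gaussianPDFReal 0 v x) := by
    refine ((hid.bdd_mul (f := f) (c := C) hfc.aestronglyMeasurable
      (ae_of_all _ hC)).const_mul (-(v : ℝ)⁻¹)).congr (ae_of_all _ fun x => ?_)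
    simp only [Pi.mul_apply]
    field_simp
  have e2 : Integrable (f' * gaussianPDFReal 0 v) :=
    hpi.bdd_mul hf'.aestronglyMeasurable (ae_of_all _ hC')
  have e3 : Integrable (f * gaussianPDFReal 0 v) :=
    hpi.bdd_mul hfc.aestronglyMeasurable (ae_of_all _ hC)
  have key := integral_mul_deriv_eq_deriv_mul_of_integrable (u := f) (v := gaussianPDFReal 0 v)
    (fun x _ => hf x) (fun x _ => hasDerivAt_gaussianPDFReal_zero hv x) e1 e2 e3
  rw [integral_gaussianReal_eq_integral_smul hv, integral_gaussianReal_eq_integral_smul hv]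
  simp only [smul_eq_mul]
  calc ∫ x, gaussianPDFReal 0 v x * (f x * x)
      = ∫ x, -(v : ℝ) * (f x * (-(x / v) * gaussianPDFReal 0 v x)) := by
        congr 1; ext x; field_simp
    _ = v * ∫ x, gaussianPDFReal 0 v x * f' x := by
        rw [integral_const_mul, key, neg_mul_neg]
        congr 2; ext x; ring

end Stein

variable {X : Type*} [NormedAddCommGroup X] [NormedSpace ℝ X] [MeasurableSpace X] [BorelSpace X]
  {γ : Measure X}

lemma embed_smul [IsGaussian γ] (c : ℝ) (h : CameronMartin γ) :
    embed γ (c • h) = c • embed γ h := by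
  unfold embed
  rw [← integral_smul]
  refine integral_congr_ae ?_
  filter_upwards [Lp.coeFn_smul c (h : Lp ℝ 2 γ)] with x hx
  simp only [Submodule.coe_smul, hx, Pi.smul_apply, smul_assoc]

lemma integrable_dual_mul [IsGaussian γ] (M L : StrongDual ℝ X) :
    Integrable (fun x => M x * L x) γ :=
  (IsGaussian.memLp_dual γ M 2 (by simp)).integrable_mul (IsGaussian.memLp_dual γ L 2 (by simp))

variable [CompleteSpace X] [SecondCountableTopology X]

section Embed

lemma integrable_smul_id [IsGaussian γ] (w : Lp ℝ 2 γ) : Integrable (fun x => w x • x) γ :=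
  (IsGaussian.memLp_two_id (μ := γ)).smul (Lp.memLp w) |>.integrable le_rfl

lemma embed_add [IsGaussian γ] (h k : CameronMartin γ) :
    embed γ (h + k) = embed γ h + embed γ k := by
  unfold embed
  rw [← integral_add (integrable_smul_id _) (integrable_smul_id _)]
  refine integral_congr_ae ?_
  filter_upwards [Lp.coeFn_add (h : Lp ℝ 2 γ) k] with x hx
  simp only [Submodule.coe_add, hx, Pi.add_apply, add_smul]

/-- The embedding of the Cameron-Martin space as a linear map. -/
noncomputable def embedLinear (γ : Measure X) [IsGaussian γ] : CameronMartin γ →ₗ[ℝ] X where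
  toFun := embed γ
  map_add' := embed_add
  map_smul' := embed_smul

lemma apply_embed [IsGaussian γ] (M : StrongDual ℝ X) (h : CameronMartin γ) :
    M (embed γ h) = ∫ x, (h : Lp ℝ 2 γ) x * M x ∂γ := by
  unfold embed
  rw [← ContinuousLinearMap.integral_comp_comm M (integrable_smul_id _)]
  simp

lemma toLp_coeFn [IsGaussian γ] (L : StrongDual ℝ X) : StrongDual.toLp γ 2 L =ᵐ[γ] L := by
  rw [StrongDual.toLp_apply IsGaussian.memLp_two_id]
  exact MemLp.coeFn_toLp _

lemma apply_embed_of_toLp [IsGaussian γ] {L : StrongDual ℝ X} {h : CameronMartin γ}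
    (hL : StrongDual.toLp γ 2 L = (h : Lp ℝ 2 γ)) (M : StrongDual ℝ X) :
    M (embed γ h) = ∫ x, L x * M x ∂γ := by
  rw [apply_embed, ← hL]
  refine integral_congr_ae ?_
  filter_upwards [toLp_coeFn (γ := γ) L] with x hx
  rw [hx]

end Embed

section GaussianIBP

/-- Integration by parts for a centred Gaussian measure, in the direction of a vector of the
Cameron-Martin space that comes from the dual. -/
lemma integral_fderiv_embed (hγ : IsCentredNondegenerateGaussian γ) {L : StrongDual ℝ X}
    {h : CameronMartin γ} (hL : StrongDual.toLp γ 2 L = (h : Lp ℝ 2 γ))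
    {φ : X → ℝ} (hφ : ContDiff ℝ 1 φ) {C C' : ℝ} (hC : ∀ x, |φ x| ≤ C)
    (hC' : ∀ x, ‖fderiv ℝ φ x‖ ≤ C') :
    ∫ x, fderiv ℝ φ x (embed γ h) ∂γ = ∫ x, φ x * L x ∂γ := by
  have := hγ.isGaussian
  by_cases hL0 : L = 0
  · have : embed γ h = 0 := by
      have h0 : (h : Lp ℝ 2 γ) = 0 := by rw [← hL, hL0, map_zero]
      have h0' : h = 0 := by exact_mod_cast h0
      rw [h0']
      exact (embedLinear γ).map_zero
    simp [this, hL0]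
  set H := embed γ h with hH
  set σ := ∫ x, (L x) ^ 2 ∂γ with hσ
  have hσ0 : 0 < σ := hγ.nondegenerate L hL0
  have hLH : ∀ M : StrongDual ℝ X, M H = ∫ x, L x * M x ∂γ := apply_embed_of_toLp hL
  have hLH' : L H = σ := by rw [hLH, hσ]; congr 1; ext x; ring
  -- The scaling gives `L H' = 1`, so `Y` is the projection onto `ker L` along `H'`. Since `L₁ H = ∫
  -- L L₁`, each `L₁ ∘ Y` is uncorrelated with `L`; being jointly Gaussian, `Y` and `L` are
  -- independent.
  set H' := σ⁻¹ • H with hH'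
  let Y : X →L[ℝ] X := ContinuousLinearMap.id ℝ X - L.smulRight H'
  have hY : ∀ x, Y x + L x • H' = x := fun x => by simp [Y]
  have hind : IndepFun Y L γ := by
    have hG : HasGaussianLaw (fun x => (Y x, L x)) γ := by
      have : HasGaussianLaw (Y.prod L) γ := ⟨inferInstance⟩
      exact this
    refine hG.indepFun_of_covariance_strongDual fun L₁ L₂ => ?_
    have e1 : (L₁ ∘ Y : X → ℝ) = (L₁.comp Y : StrongDual ℝ X) := rfl
    have e2 : (L₂ ∘ L : X → ℝ) = (L₂.comp L : StrongDual ℝ X) := rfl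
    rw [e1, e2, covariance_eq_sub (IsGaussian.memLp_dual γ _ 2 (by simp))
      (IsGaussian.memLp_dual γ _ 2 (by simp)), hγ.centred, zero_mul, sub_zero]
    have e3 : ∀ x, ((L₁.comp Y : StrongDual ℝ X) * (L₂.comp L : StrongDual ℝ X) : X → ℝ) x
        = L₂ 1 * (L x * L₁ x - L₁ H' * (L x) ^ 2) := fun x => by
      have : L₂ (L x) = L x * L₂ 1 := by
        rw [← smul_eq_mul, ← map_smul, smul_eq_mul, mul_one]
      simp [Y, this]
      ring
    rw [integral_congr_ae (ae_of_all _ e3), integral_const_mul, integral_sub, integral_const_mul,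
      ← hLH, ← hσ, hH', map_smul, smul_eq_mul]
    · field_simp; simp
    · exact integrable_dual_mul L L₁
    · exact ((integrable_dual_mul L L).congr (ae_of_all _ fun x => by ring)).const_mul _
  set v : ℝ≥0 := σ.toNNReal with hv
  have hvσ : (v : ℝ) = σ := Real.coe_toNNReal _ hσ0.le
  have hv0 : v ≠ 0 := by simpa [hv] using hσ0
  have hlaw : γ.map L = gaussianReal 0 v := by
    rw [IsGaussian.map_eq_gaussianReal L, hγ.centred,
      variance_of_integral_eq_zero (by fun_prop) (hγ.centred L)]
  have hprod : γ.map (fun x => (Y x, L x)) = (γ.map Y).prod (gaussianReal 0 v) := by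
    rw [← hlaw]
    exact (indepFun_iff_map_prod_eq_prod_map_map (by fun_prop) (by fun_prop)).1 hind
  have hd : ∀ y s, HasDerivAt (fun s : ℝ => φ (y + s • H')) (fderiv ℝ φ (y + s • H') H') s := by
    intro y s
    have h1 : HasDerivAt (fun s : ℝ => y + s • H') H' s := by
      simpa using ((hasDerivAt_id s).smul_const H').const_add y
    exact (((hφ.differentiable (by simp)) (y + s • H')).hasFDerivAt).comp_hasDerivAt s h1
  have hfc : Continuous (fderiv ℝ φ) := hφ.continuous_fderiv (by simp)
  have : IsProbabilityMeasure (γ.map Y) := Measure.isProbabilityMeasure_map (by fun_prop)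
  have hφc := hφ.continuous
  have i1 : Integrable (fun p : X × ℝ => fderiv ℝ φ (p.1 + p.2 • H') H)
      ((γ.map Y).prod (gaussianReal 0 v)) := by
    refine Integrable.of_bound (C := C' * ‖H‖) (Continuous.aestronglyMeasurable (by fun_prop))
      (ae_of_all _ fun p => ?_)
    exact (ContinuousLinearMap.le_opNorm _ _).trans
      (mul_le_mul_of_nonneg_right (hC' _) (norm_nonneg _))
  have i2 : Integrable (fun p : X × ℝ => φ (p.1 + p.2 • H') * p.2)
      ((γ.map Y).prod (gaussianReal 0 v)) := by
    have : Integrable (fun p : X × ℝ => p.2) ((γ.map Y).prod (gaussianReal 0 v)) :=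
      ((memLp_id_gaussianReal (μ := 0) (v := v) 1).integrable (by simp)).comp_snd _
    exact this.bdd_mul (c := C) (Continuous.aestronglyMeasurable (by fun_prop))
      (ae_of_all _ fun p => hC _)
  calc ∫ x, fderiv ℝ φ x H ∂γ
      = ∫ p, fderiv ℝ φ (p.1 + p.2 • H') H ∂(γ.map (fun x => (Y x, L x))) := by
        rw [integral_map (by fun_prop) (Continuous.aestronglyMeasurable (by fun_prop))]
        simp only [hY]
    _ = ∫ y, ∫ s, fderiv ℝ φ (y + s • H') H ∂(gaussianReal 0 v) ∂(γ.map Y) := by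
        rw [hprod, integral_prod _ i1]
    _ = ∫ y, ∫ s, φ (y + s • H') * s ∂(gaussianReal 0 v) ∂(γ.map Y) := by
        congr 1; ext y
        -- Stein's identity on the line `y + ℝ H'`; its factor `v = σ` turns `H'` back into `H`.
        rw [integral_mul_id_gaussianReal hv0 (hd y) (by fun_prop) (fun s => hC _)
          (C' := C' * ‖H'‖) (fun s => (ContinuousLinearMap.le_opNorm _ _).trans
            (mul_le_mul_of_nonneg_right (hC' _) (norm_nonneg _))), ← integral_const_mul]
        congr 1; ext s
        rw [hvσ, hH', map_smul, smul_eq_mul]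
        field_simp
    _ = ∫ p, φ (p.1 + p.2 • H') * p.2 ∂(γ.map (fun x => (Y x, L x))) := by
        rw [hprod, integral_prod _ i2]
    _ = ∫ x, φ x * L x ∂γ := by
        rw [integral_map (by fun_prop) (Continuous.aestronglyMeasurable (by fun_prop))]
        simp only [hY]

end GaussianIBP

end GaussianIntegrationByParts

/-! ### Cylindrical approximation of bounded Lipschitz functions. -/

section LipschitzApproximation

section Smoothing

open scoped Convolution

/-- A bounded Lipschitz function on a finite-dimensional space is a pointwise limit of `C¹`
functions with the same bound and the same Lipschitz constant. -/
lemma exists_contDiff_tendsto_of_lipschitz {m : ℕ} {G : (Fin m → ℝ) → ℝ} {K : ℝ≥0} {M : ℝ}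
    (hG : LipschitzWith K G) (hM : ∀ y, |G y| ≤ M) :
    ∃ g : ℕ → (Fin m → ℝ) → ℝ, (∀ n, ContDiff ℝ 1 (g n)) ∧ (∀ n, LipschitzWith K (g n)) ∧
      (∀ n y, |g n y| ≤ M) ∧ ∀ y, Tendsto (fun n => g n y) atTop (𝓝 (G y)) := by
  let φ : ℕ → ContDiffBump (0 : Fin m → ℝ) := fun n =>
    ⟨1 / ((n : ℝ) + 1) / 2, 1 / ((n : ℝ) + 1), by positivity, by
      have : (0 : ℝ) < 1 / ((n : ℝ) + 1) := by positivity
      linarith⟩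
  let g : ℕ → (Fin m → ℝ) → ℝ := fun n =>
    (φ n).normed volume ⋆[ContinuousLinearMap.lsmul ℝ ℝ, volume] G
  have hg : ∀ n y, g n y = ∫ t, (φ n).normed volume t * G (y - t) := fun n y => rfl
  have hGc := hG.continuous
  have hint : ∀ n y, Integrable (fun t => (φ n).normed volume t * G (y - t)) := fun n y => by
    refine Integrable.mul_bdd (c := M) ((φ n).integrable_normed (μ := volume))
      (Continuous.aestronglyMeasurable (by fun_prop)) (ae_of_all _ fun t => hM _)
  -- Averaging against a probability density preserves bounds. Applied to `G` this gives the bound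
  -- `M`; applied to differences of translates of `G` it gives the Lipschitz constant.
  have hbd : ∀ n (F : (Fin m → ℝ) → ℝ) (c : ℝ), (∀ t, |F t| ≤ c) →
      |∫ t, (φ n).normed volume t * F t| ≤ c := fun n F c hF => by
    calc |∫ t, (φ n).normed volume t * F t|
        ≤ ∫ t, (φ n).normed volume t * c := by
          rw [← Real.norm_eq_abs]
          have hi : Integrable ((φ n).normed volume) := (φ n).integrable_normed
          refine norm_integral_le_of_norm_le (hi.mul_const c) (ae_of_all _ fun t => ?_)
          rw [norm_mul, Real.norm_of_nonneg ((φ n).nonneg_normed t)]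
          exact mul_le_mul_of_nonneg_left (hF t) ((φ n).nonneg_normed t)
      _ = c := by rw [integral_mul_const, (φ n).integral_normed, one_mul]
  refine ⟨g, fun n => ?_, fun n => ?_, fun n y => ?_, fun y => ?_⟩
  · exact (φ n).hasCompactSupport_normed.contDiff_convolution_left (n := 1) _
      (φ n).contDiff_normed hGc.locallyIntegrable
  · refine LipschitzWith.of_dist_le_mul fun y z => ?_
    rw [Real.dist_eq, hg, hg, ← integral_sub (hint n y) (hint n z)]
    simp_rw [← mul_sub]
    refine hbd n _ _ fun t => ?_
    simpa [Real.dist_eq] using hG.dist_le_mul (y - t) (z - t)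
  · rw [hg]
    exact hbd n _ _ fun t => hM _
  · exact ContDiffBump.convolution_tendsto_right_of_continuous
      tendsto_one_div_add_atTop_nhds_zero_nat hGc y

end Smoothing

section FiniteSuprema

variable {E ι : Type*} [PseudoMetricSpace E] {K : ℝ≥0} {f : ι → E → ℝ} {s : Finset ι}

lemma _root_.LipschitzWith.finset_sup' (hs : s.Nonempty) (hf : ∀ j, LipschitzWith K (f j)) :
    LipschitzWith K fun y => s.sup' hs fun j => f j y := by
  refine LipschitzWith.of_le_add_mul K fun x y => Finset.sup'_le _ _ fun j hj => ?_
  refine ((hf j).le_add_mul x y).trans ?_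
  gcongr
  exact Finset.le_sup' (fun j => f j y) hj

lemma _root_.LipschitzWith.finset_inf' (hs : s.Nonempty) (hf : ∀ j, LipschitzWith K (f j)) :
    LipschitzWith K fun y => s.inf' hs fun j => f j y := by
  refine LipschitzWith.of_le_add_mul K fun x y => ?_
  rw [← sub_le_iff_le_add]
  refine Finset.le_inf' _ _ fun j hj => ?_
  rw [sub_le_iff_le_add]
  exact (Finset.inf'_le (fun j => f j x) hj).trans ((hf j).le_add_mul x y)

end FiniteSuprema

variable {X : Type*} [NormedAddCommGroup X] [NormedSpace ℝ X]

/-- A separable normed space has a norming sequence of functionals. -/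
lemma exists_norming_sequence [TopologicalSpace.SeparableSpace X] :
    ∃ l : ℕ → StrongDual ℝ X, (∀ j, ‖l j‖ ≤ 1) ∧
      ∀ z, Tendsto (fun m : ℕ => Finset.univ.sup' Finset.univ_nonempty
        fun j : Fin (m + 1) => l j z) atTop (𝓝 ‖z‖) := by
  choose l hl1 hl2 using fun j : ℕ => exists_dual_vector'' ℝ (TopologicalSpace.denseSeq X j)
  have hle : ∀ j z, l j z ≤ ‖z‖ := fun j z =>
    (le_abs_self _).trans (((l j).le_opNorm z).trans
      (by simpa using mul_le_mul_of_nonneg_right (hl1 j) (norm_nonneg z)))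
  refine ⟨l, hl1, fun z => ?_⟩
  rw [Metric.tendsto_atTop]
  intro ε hε
  obtain ⟨j, hj⟩ := (TopologicalSpace.denseRange_denseSeq X).exists_dist_lt z (half_pos hε)
  refine ⟨j, fun m hm => ?_⟩
  set d := TopologicalSpace.denseSeq X j
  have h1 : l j z ≤ Finset.univ.sup' Finset.univ_nonempty fun j : Fin (m + 1) => l j z :=
    Finset.le_sup' (fun j : Fin (m + 1) => l j z) (Finset.mem_univ (⟨j, by omega⟩ : Fin (m + 1)))
  have h2 : (Finset.univ.sup' Finset.univ_nonempty fun j : Fin (m + 1) => l j z) ≤ ‖z‖ :=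
    Finset.sup'_le _ _ fun i _ => hle i z
  have h3 : l j d = ‖d‖ := hl2 j
  have h4 : l j (d - z) ≤ ‖d - z‖ := hle j _
  have h5 : ‖z‖ - ‖d‖ ≤ ‖z - d‖ := norm_sub_norm_le z d
  rw [dist_eq_norm] at hj
  rw [norm_sub_rev, map_sub] at h4
  rw [Real.dist_eq, abs_lt]
  constructor <;> linarith

/-- To prove a property of all `K`-Lipschitz functions bounded by `M` it is enough to prove it
for the cylindrical ones, and to show that it passes to pointwise limits of sequences. -/
theorem lipschitz_induction [TopologicalSpace.SeparableSpace X] {K : ℝ≥0} {M : ℝ}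
    {P : (X → ℝ) → Prop}
    (cyl : ∀ φ, IsCylindricalC1b φ → LipschitzWith K φ → (∀ x, |φ x| ≤ M) → P φ)
    (lim : ∀ (F : ℕ → X → ℝ) (f : X → ℝ), (∀ n, LipschitzWith K (F n)) →
      (∀ n x, |F n x| ≤ M) → (∀ n, P (F n)) →
      (∀ x, Tendsto (fun n => F n x) atTop (𝓝 (f x))) → P f)
    {ψ : X → ℝ} (hψ : LipschitzWith K ψ) (hM : ∀ x, |ψ x| ≤ M) : P ψ := by
  have hM0 : 0 ≤ M := (abs_nonneg _).trans (hM 0)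
  obtain ⟨l, hl1, hlt⟩ := exists_norming_sequence (X := X)
  set a := TopologicalSpace.denseSeq X
  -- Truncation restores the bound `M` for the approximants; it is 1-Lipschitz and fixes the values
  -- of `ψ`.
  let clamp : ℝ → ℝ := fun t => max (-M) (min M t)
  have hclamp : ∀ t, |clamp t| ≤ M := fun t => abs_le.2
    ⟨le_max_left _ _, max_le (by linarith) (min_le_left _ _)⟩
  have hclampL : LipschitzWith 1 clamp := (LipschitzWith.id.const_min M).const_max (-M)
  have hclamp_eq : ∀ x, clamp (ψ x) = ψ x := fun x => by
    have := abs_le.1 (hM x)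
    simp only [clamp]
    rw [min_eq_right this.2, max_eq_right this.1]
  have hclampc : Continuous clamp := hclampL.continuous
  have finDim : ∀ (m : ℕ) (G : (Fin m → ℝ) → ℝ), LipschitzWith K G → (∀ y, |G y| ≤ M) →
      LipschitzWith K (fun x : X => G fun j => l j x) ∧ P (fun x => G fun j => l j x) := by
    intro m G hG hGM
    -- The sup norm on `Fin m → ℝ` matters here: with `‖l j‖ ≤ 1` the Lipschitz constant does not
    -- grow with `m`.
    have hlL : LipschitzWith 1 (fun (x : X) (j : Fin m) => l j x) :=
      LipschitzWith.of_dist_le_mul fun x y => by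
        rw [dist_pi_le_iff (by positivity)]
        intro j
        rw [Real.dist_eq, ← map_sub, dist_eq_norm]
        exact ((l j).le_opNorm _).trans
          (mul_le_mul_of_nonneg_right (by simpa using hl1 j) (norm_nonneg _))
    have hcomp : ∀ g : (Fin m → ℝ) → ℝ, LipschitzWith K g →
        LipschitzWith K (fun x : X => g fun j => l j x) := fun g hg => by
      simpa using! hg.comp hlL
    obtain ⟨g, hg1, hg2, hg3, hg4⟩ := exists_contDiff_tendsto_of_lipschitz hG hGM
    refine ⟨hcomp G hG, lim (fun n x => g n fun j => l j x) _ (fun n => hcomp _ (hg2 n))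
      (fun n x => hg3 n _) (fun n => ?_) (fun x => hg4 _)⟩
    refine cyl _ ⟨m, fun j => l j, g n, hg1 n, ⟨M, hg3 n⟩, ⟨K, fun y => ?_⟩, fun x => rfl⟩
      (hcomp _ (hg2 n)) (fun x => hg3 n _)
    exact norm_fderiv_le_of_lipschitz ℝ (hg2 n)
  -- McShane's formula, restricted to finitely many points of a dense sequence.
  let E : ℕ → X → ℝ := fun N x => Finset.univ.inf' Finset.univ_nonempty
    fun k : Fin (N + 1) => ψ (a k) + K * ‖x - a k‖
  have hE : ∀ N, LipschitzWith K (fun x => clamp (E N x)) ∧ P (fun x => clamp (E N x)) := by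
    intro N
    have hL : LipschitzWith K (E N) := by
      refine LipschitzWith.finset_inf' _ fun k => LipschitzWith.of_le_add_mul K fun x y => ?_
      have : ‖x - a k‖ ≤ ‖y - a k‖ + dist x y := by
        rw [dist_eq_norm, add_comm ‖y - a k‖]
        simpa using norm_add_le (x - y) (y - a k)
      nlinarith [mul_le_mul_of_nonneg_left this K.2]
    refine ⟨by simpa using! hclampL.comp hL, ?_⟩
    -- Replacing each norm by a maximum of finitely many functionals leaves a function of finitely
    -- many coordinates.
    let G : (m : ℕ) → (Fin (m + 1) → ℝ) → ℝ := fun m y =>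
      clamp (Finset.univ.inf' Finset.univ_nonempty fun k : Fin (N + 1) =>
        ψ (a k) + K * Finset.univ.sup' Finset.univ_nonempty fun j : Fin (m + 1) => y j - l j (a k))
    have hG : ∀ m, LipschitzWith K (G m) := fun m => by
      suffices h : LipschitzWith K fun y : Fin (m + 1) → ℝ =>
          (Finset.univ.inf' Finset.univ_nonempty fun k : Fin (N + 1) => ψ (a k) +
            K * Finset.univ.sup' Finset.univ_nonempty fun j : Fin (m + 1) => y j - l j (a k)) by
        simpa using! hclampL.comp h
      refine LipschitzWith.finset_inf' _ fun k => LipschitzWith.of_le_add_mul K fun y z => ?_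
      have h1 : LipschitzWith 1 fun y : Fin (m + 1) → ℝ =>
          Finset.univ.sup' Finset.univ_nonempty fun j : Fin (m + 1) => y j - l j (a k) :=
        LipschitzWith.finset_sup' _ fun j => LipschitzWith.of_le_add fun y z => by
          have := (le_abs_self _).trans (dist_le_pi_dist y z j)
          linarith
      have h2 := h1.le_add_mul y z
      simp only [NNReal.coe_one, one_mul] at h2
      nlinarith [mul_le_mul_of_nonneg_left h2 K.2]
    refine lim (fun m x => G m fun j => l j x) _ (fun m => (finDim _ _ (hG m) fun y => hclamp _).1)
      (fun m x => hclamp _) (fun m => (finDim _ _ (hG m) fun y => hclamp _).2) fun x => ?_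
    refine (hclampc.tendsto _).comp ?_
    refine Filter.Tendsto.finset_inf'_nhds_apply _ fun k _ => ?_
    refine Filter.Tendsto.const_add _ (Filter.Tendsto.const_mul _ ?_)
    simpa only [map_sub] using hlt (x - a k)
  refine lim (fun N x => clamp (E N x)) ψ (fun N => (hE N).1) (fun N x => hclamp _)
    (fun N => (hE N).2) fun x => ?_
  rw [← hclamp_eq x]
  refine (hclampc.tendsto _).comp ?_
  rw [Metric.tendsto_atTop]
  intro ε hε
  -- The error `E N x - ψ x` is at most `2 K ‖x - a k‖`; the `+ 1` covers `K = 0`.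
  obtain ⟨k, hk⟩ := (TopologicalSpace.denseRange_denseSeq X).exists_dist_lt x
    (ε := ε / (2 * K + 1)) (by positivity)
  refine ⟨k, fun N hN => ?_⟩
  have h1 : ψ x ≤ E N x := by
    refine Finset.le_inf' _ _ fun i _ => ?_
    simpa [dist_eq_norm] using hψ.le_add_mul x (a i)
  have h2 : E N x ≤ ψ (a k) + K * ‖x - a k‖ :=
    Finset.inf'_le (fun k : Fin (N + 1) => ψ (a k) + K * ‖x - a k‖)
      (Finset.mem_univ (⟨k, by omega⟩ : Fin (N + 1)))
  have h3 := hψ.le_add_mul (a k) x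
  rw [dist_comm, dist_eq_norm] at h3
  rw [dist_eq_norm, lt_div_iff₀ (by positivity)] at hk
  have h4 : 0 ≤ ‖x - a k‖ := norm_nonneg _
  change ‖x - a k‖ * _ < ε at hk
  rcases h4.eq_or_lt with h0 | h0
  · rw [← h0] at h2 h3
    rw [Real.dist_eq, abs_lt]
    constructor <;> linarith
  · rw [Real.dist_eq, abs_lt]
    constructor <;> nlinarith

end LipschitzApproximation

/-! ### Cylindrical functions and their totality in the dual of `L¹(γ)`. -/

section CylindricalFunctions

section C1b

variable {E F : Type*} [NormedAddCommGroup E] [NormedSpace ℝ E] [NormedAddCommGroup F]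
  [NormedSpace ℝ F]

/-- Bounded continuously differentiable functions with bounded derivative. -/
structure IsC1b (f : E → ℝ) : Prop where
  contDiff : ContDiff ℝ 1 f
  bounded : ∃ C : ℝ, ∀ x, |f x| ≤ C
  fderiv_bounded : ∃ C : ℝ, ∀ x, ‖fderiv ℝ f x‖ ≤ C

lemma IsC1b.differentiable {f : E → ℝ} (hf : IsC1b f) : Differentiable ℝ f :=
  hf.contDiff.differentiable (by simp)

lemma IsC1b.comp_clm {g : F → ℝ} (hg : IsC1b g) (T : E →L[ℝ] F) : IsC1b fun x => g (T x) := by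
  obtain ⟨C, hC⟩ := hg.bounded
  obtain ⟨D, hD⟩ := hg.fderiv_bounded
  refine ⟨hg.contDiff.comp T.contDiff, ⟨C, fun x => hC _⟩, ⟨D * ‖T‖, fun x => ?_⟩⟩
  have : fderiv ℝ (fun x => g (T x)) x = (fderiv ℝ g (T x)).comp T :=
    ((hg.differentiable (T x)).hasFDerivAt.comp x T.hasFDerivAt).fderiv
  rw [this]
  exact (ContinuousLinearMap.opNorm_comp_le _ _).trans
    (mul_le_mul_of_nonneg_right (hD _) (norm_nonneg _))

lemma IsC1b.mul {f g : E → ℝ} (hf : IsC1b f) (hg : IsC1b g) : IsC1b fun x => f x * g x := by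
  obtain ⟨C, hC⟩ := hf.bounded
  obtain ⟨D, hD⟩ := hf.fderiv_bounded
  obtain ⟨C', hC'⟩ := hg.bounded
  obtain ⟨D', hD'⟩ := hg.fderiv_bounded
  refine ⟨hf.contDiff.mul hg.contDiff, ⟨C * C', fun x => ?_⟩, ⟨C * D' + C' * D, fun x => ?_⟩⟩
  · rw [abs_mul]
    exact mul_le_mul (hC x) (hC' x) (abs_nonneg _) ((abs_nonneg _).trans (hC x))
  · rw [fderiv_fun_mul (hf.differentiable x) (hg.differentiable x)]
    refine (norm_add_le _ _).trans (add_le_add ?_ ?_)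
    · rw [norm_smul]
      exact mul_le_mul (hC x) (hD' x) (norm_nonneg _) ((abs_nonneg _).trans (hC x))
    · rw [norm_smul]
      exact mul_le_mul (hC' x) (hD x) (norm_nonneg _) ((abs_nonneg _).trans (hC' x))

lemma isC1b_cos : IsC1b Real.cos := by
  refine ⟨Real.contDiff_cos, ⟨1, Real.abs_cos_le_one⟩, ⟨1, fun x => ?_⟩⟩
  rw [← norm_deriv_eq_norm_fderiv, Real.deriv_cos, norm_neg]
  exact Real.abs_sin_le_one x

lemma isC1b_sin : IsC1b Real.sin := by
  refine ⟨Real.contDiff_sin, ⟨1, Real.abs_sin_le_one⟩, ⟨1, fun x => ?_⟩⟩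
  rw [← norm_deriv_eq_norm_fderiv, Real.deriv_sin]
  exact Real.abs_cos_le_one x

end C1b

variable {X : Type*} [NormedAddCommGroup X] [NormedSpace ℝ X]

section Cylindrical

lemma isCylindricalC1b_iff {f : X → ℝ} : IsCylindricalC1b f ↔
    ∃ (m : ℕ) (L : Fin m → StrongDual ℝ X) (g : (Fin m → ℝ) → ℝ),
      IsC1b g ∧ ∀ x, f x = g fun i => L i x :=
  ⟨fun ⟨m, L, g, h1, h2, h3, h4⟩ => ⟨m, L, g, ⟨h1, h2, h3⟩, h4⟩,
    fun ⟨m, L, g, ⟨h1, h2, h3⟩, h4⟩ => ⟨m, L, g, h1, h2, h3, h4⟩⟩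

lemma IsCylindricalC1b.isC1b {f : X → ℝ} (hf : IsCylindricalC1b f) : IsC1b f := by
  obtain ⟨m, L, g, hg, hfg⟩ := isCylindricalC1b_iff.1 hf
  rw [funext hfg]
  exact hg.comp_clm (ContinuousLinearMap.pi L)

lemma IsCylindricalC1b.mul {f g : X → ℝ} (hf : IsCylindricalC1b f) (hg : IsCylindricalC1b g) :
    IsCylindricalC1b fun x => f x * g x := by
  obtain ⟨m, L, F, hF, hfF⟩ := isCylindricalC1b_iff.1 hf
  obtain ⟨n, M, G, hG, hgG⟩ := isCylindricalC1b_iff.1 hg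
  let S : (Fin (m + n) → ℝ) →L[ℝ] (Fin m → ℝ) :=
    ContinuousLinearMap.pi fun i => ContinuousLinearMap.proj (Fin.castAdd n i)
  let T : (Fin (m + n) → ℝ) →L[ℝ] (Fin n → ℝ) :=
    ContinuousLinearMap.pi fun i => ContinuousLinearMap.proj (Fin.natAdd m i)
  refine isCylindricalC1b_iff.2 ⟨m + n, Fin.append L M, fun y => F (S y) * G (T y),
    (hF.comp_clm S).mul (hG.comp_clm T), fun x => ?_⟩
  rw [hfF, hgG]
  congr 2 <;> ext i <;> simp [S, T]

lemma IsC1b.isCylindricalC1b_comp {g : ℝ → ℝ} (hg : IsC1b g) (L : StrongDual ℝ X) :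
    IsCylindricalC1b fun x => g (L x) :=
  isCylindricalC1b_iff.2 ⟨1, fun _ => L, fun y => g (y 0),
    hg.comp_clm (ContinuousLinearMap.proj (R := ℝ) (φ := fun _ : Fin 1 => ℝ) 0), fun _ => rfl⟩

variable [MeasurableSpace X] [BorelSpace X]

/-- An integrable function that is orthogonal to all cylindrical functions vanishes. -/
lemma ae_eq_zero_of_forall_cylindrical [CompleteSpace X] [SecondCountableTopology X]
    {γ : Measure X} [IsFiniteMeasure γ] {G : X → ℝ} (hG : Integrable G γ)
    (h : ∀ f, IsCylindricalC1b f → ∫ x, f x * G x ∂γ = 0) : G =ᵐ[γ] 0 := by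
  -- The positive and negative parts of `G` are densities of two finite measures. Their
  -- characteristic functions agree because `cos ∘ L` and `sin ∘ L` are cylindrical.
  set μ := γ.withDensity fun x => ENNReal.ofReal (G x) with hμ
  set ν := γ.withDensity fun x => ENNReal.ofReal (-G x) with hν
  have : IsFiniteMeasure μ := isFiniteMeasure_withDensity_ofReal hG.2
  have : IsFiniteMeasure ν := isFiniteMeasure_withDensity_ofReal hG.neg.2
  have m1 : AEMeasurable (fun x => ENNReal.ofReal (G x)) γ := hG.aemeasurable.ennreal_ofReal
  have m2 : AEMeasurable (fun x => ENNReal.ofReal (-G x)) γ := hG.aemeasurable.neg.ennreal_ofReal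
  have hμν : μ = ν := by
    refine Measure.ext_of_charFunDual (funext fun L => ?_)
    rw [charFunDual_apply, charFunDual_apply, hμ, hν,
      integral_withDensity_eq_integral_toReal_smul₀ m1 (ae_of_all _ fun x => by simp),
      integral_withDensity_eq_integral_toReal_smul₀ m2 (ae_of_all _ fun x => by simp),
      ← sub_eq_zero]
    have hc : Continuous fun x : X => Complex.exp (L x * Complex.I) := by fun_prop
    have hi : ∀ w : X → ℝ, Integrable w γ →
        Integrable (fun x => (ENNReal.ofReal (w x)).toReal • Complex.exp (L x * Complex.I)) γ := by
      intro w hw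
      refine hw.abs.mono' (hw.aemeasurable.ennreal_ofReal.ennreal_toReal.aestronglyMeasurable.smul
        hc.aestronglyMeasurable) (ae_of_all _ fun x => ?_)
      rw [norm_smul, Complex.norm_exp_ofReal_mul_I, mul_one, ENNReal.toReal_ofReal',
        Real.norm_of_nonneg (le_max_right _ _)]
      exact max_le (le_abs_self _) (abs_nonneg _)
    have hi1 := hi G hG
    have hi2 := hi (fun x => -G x) hG.neg
    rw [← integral_sub hi1 hi2]
    have hcos := h _ (isC1b_cos.isCylindricalC1b_comp L)
    have hsin := h _ (isC1b_sin.isCylindricalC1b_comp L)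
    have i1 : Integrable (fun x => ((Real.cos (L x) * G x : ℝ) : ℂ)) γ :=
      (hG.bdd_mul (c := 1) (Continuous.aestronglyMeasurable (by fun_prop))
        (ae_of_all _ fun x => Real.abs_cos_le_one _)).ofReal
    have i2 : Integrable (fun x => ((Real.sin (L x) * G x : ℝ) : ℂ)) γ :=
      (hG.bdd_mul (c := 1) (Continuous.aestronglyMeasurable (by fun_prop))
        (ae_of_all _ fun x => Real.abs_sin_le_one _)).ofReal
    calc _ = ∫ x, (((Real.cos (L x) * G x : ℝ) : ℂ)
          + ((Real.sin (L x) * G x : ℝ) : ℂ) * Complex.I) ∂γ := by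
          congr 1; ext x
          rw [← sub_smul, ENNReal.toReal_ofReal', ENNReal.toReal_ofReal',
            max_zero_sub_max_neg_zero_eq_self, Complex.exp_mul_I, Complex.real_smul]
          push_cast
          ring
      _ = 0 := by
          rw [integral_add i1 (i2.mul_const _), integral_mul_const, integral_complex_ofReal,
            integral_complex_ofReal, hcos, hsin]
          simp
  have hae := (withDensity_eq_iff m1 m2 (by
    have := measure_ne_top μ Set.univ
    rwa [hμ, withDensity_apply _ .univ, Measure.restrict_univ] at this)).1 hμν
  filter_upwards [hae] with x hx
  have hx' := congrArg ENNReal.toReal hx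
  rw [ENNReal.toReal_ofReal', ENNReal.toReal_ofReal', ← sub_eq_zero,
    max_zero_sub_max_neg_zero_eq_self] at hx'
  exact hx'

end Cylindrical

end CylindricalFunctions

/-! ### Divergence of Lipschitz fields and its locality. -/

section WeakDivergence

section BoundedFunctions

variable {Y : Type*} [MeasurableSpace Y] {γ : Measure Y}

/-- `Λ` is continuous along bounded pointwise convergent sequences of measurable functions. -/
def IsBoundedlyContinuous (Λ : (Y → ℝ) → ℝ) : Prop :=
  ∀ (F : ℕ → Y → ℝ) (f : Y → ℝ) (C : ℝ), (∀ n, Measurable (F n)) → (∀ n x, |F n x| ≤ C) →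
    (∀ x, Tendsto (fun n => F n x) atTop (𝓝 (f x))) →
    Tendsto (fun n => Λ (F n)) atTop (𝓝 (Λ f))

lemma isBoundedlyContinuous_integral {k : Y → ℝ} (hk : Integrable k γ) :
    IsBoundedlyContinuous fun φ => ∫ x, φ x * k x ∂γ := by
  intro F f C hF hC hlim
  refine tendsto_integral_of_dominated_convergence (fun x => C * |k x|)
    (fun n => (hF n).aestronglyMeasurable.mul hk.aestronglyMeasurable) (hk.abs.const_mul C)
    (fun n => ae_of_all _ fun x => ?_) (ae_of_all _ fun x => (hlim x).mul_const _)
  rw [Real.norm_eq_abs, abs_mul]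
  exact mul_le_mul_of_nonneg_right (hC n x) (abs_nonneg _)

variable [TopologicalSpace Y] [OpensMeasurableSpace Y]

/-- A product of a bounded continuous function and an integrable one is integrable. -/
lemma integrable_continuous_mul {f k : Y → ℝ} (hf : Continuous f) {C : ℝ}
    (hC : ∀ x, |f x| ≤ C) (hk : Integrable k γ) : Integrable (fun x => f x * k x) γ :=
  hk.bdd_mul (c := C) hf.aestronglyMeasurable (ae_of_all _ hC)

/-- A product of a bounded continuous function and a square integrable one is square integrable. -/
lemma memLp_continuous_mul {f k : Y → ℝ} (hf : Continuous f) {C : ℝ}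
    (hC : ∀ x, |f x| ≤ C) (hk : MemLp k 2 γ) : MemLp (fun x => f x * k x) 2 γ :=
  hk.mul' (memLp_top_of_bound hf.aestronglyMeasurable C (ae_of_all _ hC))

end BoundedFunctions

variable {X : Type*} [NormedAddCommGroup X] [NormedSpace ℝ X] [MeasurableSpace X] [BorelSpace X]
  {γ : Measure X}

lemma IsC1b.partialDeriv_eq {f : X → ℝ} (hf : IsC1b f) (h : CameronMartin γ) (x : X) :
    partialDeriv γ h f x = fderiv ℝ f x (embed γ h) :=
  (hf.differentiable x).lineDeriv_eq_fderiv

lemma IsC1b.continuous_partialDeriv {f : X → ℝ} (hf : IsC1b f) (h : CameronMartin γ) :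
    Continuous (partialDeriv γ h f) := by
  rw [funext (hf.partialDeriv_eq h)]
  exact (hf.contDiff.continuous_fderiv (by simp)).clm_apply continuous_const

lemma IsC1b.exists_bound_partialDeriv {f : X → ℝ} (hf : IsC1b f) (h : CameronMartin γ) :
    ∃ C, ∀ x, |partialDeriv γ h f x| ≤ C := by
  obtain ⟨D, hD⟩ := hf.fderiv_bounded
  refine ⟨D * ‖embed γ h‖, fun x => ?_⟩
  rw [hf.partialDeriv_eq]
  exact ((fderiv ℝ f x).le_opNorm _).trans (mul_le_mul_of_nonneg_right (hD x) (norm_nonneg _))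

lemma IsC1b.partialDeriv_mul {f φ : X → ℝ} (hf : IsC1b f) (hφ : IsC1b φ) (h : CameronMartin γ)
    (x : X) : partialDeriv γ h (fun x => f x * φ x) x
      = f x * partialDeriv γ h φ x + φ x * partialDeriv γ h f x := by
  rw [(hf.mul hφ).partialDeriv_eq, hf.partialDeriv_eq, hφ.partialDeriv_eq,
    fderiv_fun_mul (hf.differentiable x) (hφ.differentiable x)]
  simp

lemma IsC1b.memLp_adjointDeriv [IsFiniteMeasure γ] {φ : X → ℝ} (hφ : IsC1b φ)
    (h : CameronMartin γ) : MemLp (adjointDeriv γ h φ) 2 γ := by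
  obtain ⟨C, hC⟩ := hφ.bounded
  obtain ⟨D, hD⟩ := hφ.exists_bound_partialDeriv h
  exact (MemLp.of_bound (hφ.continuous_partialDeriv h).aestronglyMeasurable D (ae_of_all _ hD)).sub
    (memLp_continuous_mul hφ.contDiff.continuous hC (Lp.memLp _))

/-- A function `w ∈ L²(γ)` whose weak derivative along `h` is the functional `Λ`. -/
structure IsDualPair (γ : Measure X) (h : CameronMartin γ) (w : X → ℝ) (Λ : (X → ℝ) → ℝ) :
    Prop where
  memLp : MemLp w 2 γ
  integral_by_parts : ∀ φ, IsCylindricalC1b φ → ∫ x, w x * adjointDeriv γ h φ x ∂γ = -Λ φ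
  continuous : IsBoundedlyContinuous Λ

/-- `g ∈ L²(γ)` is the divergence of the field `x ↦ ψ x • h`, in duality with all functions that
have a weak derivative along `h`. -/
structure IsWeakDivergence (γ : Measure X) (h : CameronMartin γ) (ψ g : X → ℝ) : Prop where
  memLp : MemLp g 2 γ
  integral_mul : ∀ w Λ, IsDualPair γ h w Λ → ∫ x, w x * g x ∂γ = -Λ ψ

variable [SecondCountableTopology X]

/-- Every bounded Lipschitz function has a weak divergence along every direction of the
Cameron-Martin space. -/
theorem exists_isWeakDivergence [IsProbabilityMeasure γ] (h : CameronMartin γ) {ψ : X → ℝ}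
    {K : ℝ≥0} {M : ℝ} (hψ : LipschitzWith K ψ) (hM : ∀ x, |ψ x| ≤ M) :
    ∃ g, IsWeakDivergence γ h ψ g := by
  -- The norm bound depends only on `K`, `M` and `h`, so that it is uniform along the approximating
  -- sequences.
  suffices key : ∃ G : Lp ℝ 2 γ, ‖G‖ ≤ K * ‖embed γ h‖ + M * ‖h‖ ∧
      ∀ w Λ, IsDualPair γ h w Λ → ∫ x, w x * G x ∂γ = -Λ ψ by
    obtain ⟨G, -, hG⟩ := key
    exact ⟨G, Lp.memLp G, hG⟩
  refine lipschitz_induction (P := fun ψ => ∃ G : Lp ℝ 2 γ, ‖G‖ ≤ K * ‖embed γ h‖ + M * ‖h‖ ∧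
      ∀ w Λ, IsDualPair γ h w Λ → ∫ x, w x * G x ∂γ = -Λ ψ) ?_ ?_ hψ hM
  · intro φ hφ hK hφM
    have hφ' := hφ.isC1b
    have hd : ∀ x, |partialDeriv γ h φ x| ≤ K * ‖embed γ h‖ := fun x => by
      rw [hφ'.partialDeriv_eq]
      exact ((fderiv ℝ φ x).le_opNorm _).trans
        (mul_le_mul_of_nonneg_right (norm_fderiv_le_of_lipschitz ℝ hK) (norm_nonneg _))
    have hA : MemLp (partialDeriv γ h φ) 2 γ :=
      MemLp.of_bound (hφ'.continuous_partialDeriv h).aestronglyMeasurable _ (ae_of_all _ hd)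
    have hB : MemLp (fun x => φ x * (h : Lp ℝ 2 γ) x) 2 γ :=
      memLp_continuous_mul hφ'.contDiff.continuous hφM (Lp.memLp _)
    -- For cylindrical `φ` the divergence is `∂*_h φ` itself.
    refine ⟨hA.toLp _ - hB.toLp _, (norm_sub_le _ _).trans (add_le_add ?_ ?_), fun w Λ hw => ?_⟩
    · refine (Lp.norm_le_of_ae_bound (C := K * ‖embed γ h‖) (by positivity) ?_).trans
        (by simp [measureUnivNNReal])
      filter_upwards [hA.coeFn_toLp] with x hx
      rw [hx]
      exact hd x
    · refine Lp.norm_le_mul_norm_of_ae_le_mul (g := (h : Lp ℝ 2 γ)) ?_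
      filter_upwards [hB.coeFn_toLp] with x hx
      rw [hx, norm_mul]
      exact mul_le_mul_of_nonneg_right (hφM x) (norm_nonneg _)
    · rw [← hw.integral_by_parts φ hφ]
      refine integral_congr_ae ?_
      filter_upwards [Lp.coeFn_sub (hA.toLp _) (hB.toLp _), hA.coeFn_toLp, hB.coeFn_toLp]
        with x h1 h2 h3
      rw [h1, Pi.sub_apply, h2, h3]
      rfl
  · intro F f hFK hFM hF hlim
    choose G hG1 hG2 using hF
    set R := K * ‖embed γ h‖ + M * ‖h‖
    let T : ℕ → WeakDual ℝ (Lp ℝ 2 γ) := fun n =>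
      StrongDual.toWeakDual (InnerProductSpace.toDual ℝ (Lp ℝ 2 γ) (G n))
    have hcomp := WeakDual.isCompact_closedBall (0 : StrongDual ℝ (Lp ℝ 2 γ)) R
    have hmem : ∀ n, T n ∈ WeakDual.toStrongDual ⁻¹' Metric.closedBall
        (0 : StrongDual ℝ (Lp ℝ 2 γ)) R := fun n => by
      simpa [T] using hG1 n
    -- Banach–Alaoglu along an ultrafilter: one weak limit serves all pairs `(w, Λ)` simultaneously.
    obtain ⟨l, hl, hlim'⟩ := hcomp.ultrafilter_le_nhds ((hyperfilter ℕ).map T) (by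
      rw [Filter.le_principal_iff]
      exact Filter.mem_map.2 (Filter.univ_mem' hmem))
    refine ⟨(InnerProductSpace.toDual ℝ (Lp ℝ 2 γ)).symm (WeakDual.toStrongDual l), ?_,
      fun w Λ hw => ?_⟩
    · rw [LinearIsometryEquiv.norm_map]
      simpa using hl
    · have hinner : ∀ V : Lp ℝ 2 γ, ∫ x, w x * V x ∂γ = inner ℝ V (hw.memLp.toLp w) := fun V => by
        rw [L2.inner_def]
        refine integral_congr_ae ?_
        filter_upwards [hw.memLp.coeFn_toLp] with x hx
        rw [hx]
        rfl
      have e1 : Tendsto (fun n => -Λ (F n)) (hyperfilter ℕ)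
          (𝓝 (WeakDual.toStrongDual l (hw.memLp.toLp w))) := by
        have := ((WeakDual.eval_continuous (𝕜 := ℝ) (hw.memLp.toLp w)).tendsto l).comp hlim'
        refine this.congr fun n => ?_
        rw [← hG2 n w Λ hw, hinner]
        simp [T]
      have e2 : Tendsto (fun n => -Λ (F n)) (hyperfilter ℕ) (𝓝 (-Λ f)) :=
        ((hw.continuous F f M (fun n => (hFK n).continuous.measurable) hFM hlim).neg).mono_left
          Nat.hyperfilter_le_atTop
      rw [hinner, InnerProductSpace.toDual_symm_apply]
      exact tendsto_nhds_unique e1 e2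

section Pairs

variable [CompleteSpace X]

/-- Cylindrical functions are weakly differentiable, the weak derivative being the classical
one. -/
lemma isDualPair_of_isCylindricalC1b (hγ : IsCentredNondegenerateGaussian γ)
    {L : StrongDual ℝ X} {h : CameronMartin γ} (hL : StrongDual.toLp γ 2 L = (h : Lp ℝ 2 γ))
    {f : X → ℝ} (hf : IsCylindricalC1b f) :
    IsDualPair γ h f fun φ => ∫ x, φ x * partialDeriv γ h f x ∂γ := by
  have := hγ.isGaussian
  have hf' := hf.isC1b
  obtain ⟨C, hC⟩ := hf'.bounded
  obtain ⟨D, hD⟩ := hf'.exists_bound_partialDeriv h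
  have hdf : Integrable (partialDeriv γ h f) γ :=
    Integrable.of_bound (hf'.continuous_partialDeriv h).aestronglyMeasurable D (ae_of_all _ hD)
  refine ⟨MemLp.of_bound hf'.contDiff.continuous.aestronglyMeasurable C (ae_of_all _ hC),
    fun φ hφ => ?_, isBoundedlyContinuous_integral hdf⟩
  have hφ' := hφ.isC1b
  obtain ⟨Cφ, hCφ⟩ := hφ'.bounded
  obtain ⟨Cp, hCp⟩ := (hf'.mul hφ').bounded
  obtain ⟨Dp, hDp⟩ := (hf'.mul hφ').fderiv_bounded
  -- Integration by parts for the product `f φ`, followed by Leibniz' rule.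
  have hibp := integral_fderiv_embed hγ hL (hf'.mul hφ').contDiff hCp hDp
  simp_rw [← (hf'.mul hφ').partialDeriv_eq, hf'.partialDeriv_mul hφ'] at hibp
  have i1 : Integrable (fun x => φ x * partialDeriv γ h f x) γ :=
    integrable_continuous_mul hφ'.contDiff.continuous hCφ hdf
  have i2 : Integrable (fun x => f x * adjointDeriv γ h φ x) γ :=
    integrable_continuous_mul hf'.contDiff.continuous hC
      ((hφ'.memLp_adjointDeriv h).integrable (by norm_num))
  have i3 : Integrable (fun x => f x * φ x * L x) γ :=
    integrable_continuous_mul (hf'.mul hφ').contDiff.continuous hCp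
      ((IsGaussian.memLp_dual γ L 1 (by simp)).integrable le_rfl)
  have hsplit : ∫ x, (f x * partialDeriv γ h φ x + φ x * partialDeriv γ h f x) ∂γ
      = ∫ x, (f x * adjointDeriv γ h φ x + f x * φ x * L x + φ x * partialDeriv γ h f x) ∂γ := by
    refine integral_congr_ae ?_
    filter_upwards [toLp_coeFn (γ := γ) L] with x hx
    rw [hL] at hx
    rw [adjointDeriv, hx]
    ring
  have i4 : Integrable (fun x => f x * adjointDeriv γ h φ x + f x * φ x * L x) γ := i2.add i3
  rw [hsplit, integral_add i4 i1, integral_add i2 i3] at hibp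
  linarith

/-- The product of a bounded Lipschitz function and a cylindrical function is weakly
differentiable. -/
lemma IsWeakDivergence.isDualPair_mul (hγ : IsCentredNondegenerateGaussian γ)
    {L : StrongDual ℝ X} {h : CameronMartin γ} (hL : StrongDual.toLp γ 2 L = (h : Lp ℝ 2 γ))
    {ψ g : X → ℝ} (hg : IsWeakDivergence γ h ψ g) (hψ : Continuous ψ) {M : ℝ}
    (hM : ∀ x, |ψ x| ≤ M) {f : X → ℝ} (hf : IsCylindricalC1b f) :
    IsDualPair γ h (fun x => ψ x * f x) fun φ => ∫ x, φ x *
      (f x * g x + ψ x * (partialDeriv γ h f x + f x * (h : Lp ℝ 2 γ) x)) ∂γ := by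
  have := hγ.isGaussian
  have hf' := hf.isC1b
  obtain ⟨C, hC⟩ := hf'.bounded
  obtain ⟨D, hD⟩ := hf'.exists_bound_partialDeriv h
  have hfm : MemLp f 2 γ :=
    MemLp.of_bound hf'.contDiff.continuous.aestronglyMeasurable C (ae_of_all _ hC)
  have hdf : Integrable (partialDeriv γ h f) γ :=
    Integrable.of_bound (hf'.continuous_partialDeriv h).aestronglyMeasurable D (ae_of_all _ hD)
  have hh : Integrable (h : Lp ℝ 2 γ) γ := (Lp.memLp _).integrable (by norm_num)
  have j1 : Integrable (fun x => f x * g x) γ :=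
    integrable_continuous_mul hf'.contDiff.continuous hC (hg.memLp.integrable (by norm_num))
  have j2 : Integrable (fun x => ψ x * (partialDeriv γ h f x + f x * (h : Lp ℝ 2 γ) x)) γ :=
    integrable_continuous_mul hψ hM
      (hdf.add (integrable_continuous_mul hf'.contDiff.continuous hC hh))
  refine ⟨memLp_continuous_mul hψ hM hfm, fun φ hφ => ?_,
    isBoundedlyContinuous_integral (j1.add j2)⟩
  have hφ' := hφ.isC1b
  obtain ⟨Cφ, hCφ⟩ := hφ'.bounded
  -- Formally `g = ∂_h ψ - ψ ĥ`, so `f g + f ψ ĥ` stands for `f ∂_h ψ`. Pairing `g` with the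
  -- cylindrical function `f φ` makes this rigorous.
  have hcyl := hg.integral_mul _ _ (isDualPair_of_isCylindricalC1b hγ hL (hf.mul hφ))
  obtain ⟨E, hE⟩ := (hf'.mul hφ').exists_bound_partialDeriv h
  have k1 : Integrable (fun x => φ x * (f x * g x)) γ :=
    integrable_continuous_mul hφ'.contDiff.continuous hCφ j1
  have k2 : Integrable
      (fun x => φ x * (ψ x * (partialDeriv γ h f x + f x * (h : Lp ℝ 2 γ) x))) γ :=
    integrable_continuous_mul hφ'.contDiff.continuous hCφ j2
  have k3 : Integrable (fun x => ψ x * partialDeriv γ h (fun x => f x * φ x) x) γ :=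
    integrable_continuous_mul hψ hM (Integrable.of_bound
      ((hf'.mul hφ').continuous_partialDeriv h).aestronglyMeasurable E (ae_of_all _ hE))
  have hsplit : ∀ x, ψ x * f x * adjointDeriv γ h φ x
      = ψ x * partialDeriv γ h (fun x => f x * φ x) x
        - φ x * (ψ x * (partialDeriv γ h f x + f x * (h : Lp ℝ 2 γ) x)) := fun x => by
    rw [hf'.partialDeriv_mul hφ', adjointDeriv]
    ring
  have hcomm : ∫ x, φ x * (f x * g x) ∂γ = ∫ x, f x * φ x * g x ∂γ := by
    congr 1; ext x; ring
  simp_rw [hsplit, mul_add (φ _)]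
  rw [integral_sub k3 k2, integral_add k1 k2, hcomm, hcyl]
  ring

/-- Locality of the divergence: it vanishes wherever a Lipschitz cutoff equals `1`, if the field
is zero where the cutoff is not. -/
lemma IsWeakDivergence.ae_eq_zero (hγ : IsCentredNondegenerateGaussian γ)
    {L : StrongDual ℝ X} {h : CameronMartin γ} (hL : StrongDual.toLp γ 2 L = (h : Lp ℝ 2 γ))
    {ψ g : X → ℝ} (hg : IsWeakDivergence γ h ψ g) (hψ : Continuous ψ) {M : ℝ}
    (hM : ∀ x, |ψ x| ≤ M) {χ : X → ℝ} {K : ℝ≥0} (hχ : LipschitzWith K χ) {N : ℝ}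
    (hN : ∀ x, |χ x| ≤ N) (hψχ : ∀ x, ψ x * χ x = 0) :
    ∀ᵐ x ∂γ, χ x = 1 → g x = 0 := by
  have := hγ.isGaussian
  obtain ⟨k, hk⟩ := exists_isWeakDivergence h hχ hN
  have i1 : Integrable (fun x => ψ x * k x) γ :=
    integrable_continuous_mul hψ hM (hk.memLp.integrable (by norm_num))
  have i2 : Integrable (fun x => χ x * g x) γ :=
    integrable_continuous_mul hχ.continuous hN (hg.memLp.integrable (by norm_num))
  -- Formally `ψ k + χ g = ∂_h(ψ χ) - 2 ψ χ ĥ = 0`. The weak form pairs `k`, the divergence for `χ`,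
  -- with the product `ψ f`.
  have h0 := ae_eq_zero_of_forall_cylindrical (i1.add i2) fun f hf => by
    have hf' := hf.isC1b
    obtain ⟨C, hC⟩ := hf'.bounded
    have j1 := integrable_continuous_mul hf'.contDiff.continuous hC i1
    have j2 := integrable_continuous_mul hf'.contDiff.continuous hC i2
    have hpair := hk.integral_mul _ _ (hg.isDualPair_mul hγ hL hψ hM hf)
    have e1 : ∀ x, ψ x * f x * k x = f x * (ψ x * k x) := fun x => by ring
    have e2 : ∀ x, χ x * (f x * g x + ψ x * (partialDeriv γ h f x + f x * (h : Lp ℝ 2 γ) x))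
        = f x * (χ x * g x) := fun x => by
      linear_combination (partialDeriv γ h f x + f x * (h : Lp ℝ 2 γ) x) * hψχ x
    simp_rw [e1, e2] at hpair
    simp_rw [Pi.add_apply, mul_add]
    rw [integral_add j1 j2, hpair]
    ring
  filter_upwards [h0] with x hx hχx
  have h1 := hψχ x
  simp only [Pi.add_apply, hχx, one_mul, mul_one, Pi.zero_apply] at hx h1
  simpa [h1] using hx

end Pairs

end WeakDivergence

/-! ### Bumps, components of the gradient measure, and almost optimal fields. -/

section TestFields

section Bump

variable {Y : Type*} [PseudoMetricSpace Y]

/-- The real valued Lipschitz cutoff that is `1` on `E` and `0` off the `1 / (n + 1)`-thickening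
of `E`. -/
noncomputable def bump (E : Set Y) (n : ℕ) (x : Y) : ℝ :=
  thickenedIndicator (Nat.one_div_pos_of_nat : 0 < 1 / ((n : ℝ) + 1)) E x

variable (E : Set Y) (n : ℕ)

lemma bump_nonneg (x : Y) : 0 ≤ bump E n x := NNReal.coe_nonneg _

lemma bump_le_one (x : Y) : bump E n x ≤ 1 := by
  exact_mod_cast thickenedIndicator_le_one _ E x

lemma abs_bump_le_one (x : Y) : |bump E n x| ≤ 1 := by
  rw [abs_of_nonneg (bump_nonneg E n x)]
  exact bump_le_one E n x

lemma bump_eq_one {x : Y} (hx : x ∈ E) : bump E n x = 1 := by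
  simp [bump, thickenedIndicator_one _ E hx]

lemma exists_lipschitzWith_bump : ∃ K, LipschitzWith K (bump E n) :=
  ⟨_, LipschitzWith.of_dist_le_mul fun x y =>
    (lipschitzWith_thickenedIndicator
      (Nat.one_div_pos_of_nat : 0 < 1 / ((n : ℝ) + 1)) E).dist_le_mul x y⟩

lemma continuous_bump : Continuous (bump E n) :=
  (exists_lipschitzWith_bump E n).choose_spec.continuous

variable {E}

lemma tendsto_bump (hE : IsClosed E) (x : Y) :
    Tendsto (fun n => bump E n x) atTop (𝓝 (E.indicator (fun _ => 1) x)) := by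
  have h := tendsto_pi_nhds.1 (thickenedIndicator_tendsto_indicator_closure
    (fun n => (Nat.one_div_pos_of_nat : 0 < 1 / ((n : ℝ) + 1)))
    tendsto_one_div_add_atTop_nhds_zero_nat E) x
  rw [hE.closure_eq] at h
  refine ((NNReal.continuous_coe.tendsto _).comp h).congr' (by rfl) |>.trans_eq ?_
  by_cases hx : x ∈ E <;> simp [hx]

/-- A compact set has positive distance from a disjoint closed set, so sufficiently thin thickenings
stay disjoint. -/
lemma eventually_bump_mul_bump {F : Set Y} (hE : IsCompact E) (hF : IsClosed F)
    (hEF : Disjoint E F) : ∀ᶠ n in atTop, ∀ x, bump E n x * bump F n x = 0 := by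
  obtain ⟨δ, hδ, hd⟩ := hEF.exists_thickenings hE hF
  filter_upwards [tendsto_one_div_add_atTop_nhds_zero_nat.eventually (gt_mem_nhds hδ)]
    with n hn x
  by_cases hx : x ∈ Metric.thickening (1 / ((n : ℝ) + 1)) E
  · have hx' : x ∉ Metric.thickening (1 / ((n : ℝ) + 1)) F := fun h =>
      Set.disjoint_left.1 hd (Metric.thickening_mono hn.le _ hx) (Metric.thickening_mono hn.le _ h)
    simp only [bump, thickenedIndicator_zero _ F hx', NNReal.coe_zero, mul_zero]
  · simp only [bump, thickenedIndicator_zero _ E hx, NNReal.coe_zero, zero_mul]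

end Bump

variable {X : Type*} [NormedAddCommGroup X] [NormedSpace ℝ X] [MeasurableSpace X] [BorelSpace X]
  {γ : Measure X}

section Component

variable (μ : VectorMeasure X (CameronMartin γ)) (h k : CameronMartin γ)

lemma component_apply (s : Set X) : component γ μ h s = inner ℝ h (μ s) := by
  simp [component]

lemma component_add : component γ μ (h + k) = component γ μ h + component γ μ k := by
  ext s hs
  simp [component_apply, inner_add_left]

lemma component_smul (c : ℝ) : component γ μ (c • h) = c • component γ μ h := by
  ext s hs
  simp [component_apply, real_inner_smul_left]

lemma variation_component_le (hh : ‖h‖ ≤ 1) : (component γ μ h).variation ≤ μ.variation := by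
  refine VectorMeasure.variation_le_of_forall_enorm_le fun s _ => ?_
  refine le_trans ?_ (VectorMeasure.enorm_measure_le_variation μ s)
  rw [component_apply, enorm_le_iff_norm_le]
  exact (norm_inner_le_norm _ _).trans (mul_le_of_le_one_left (norm_nonneg _) hh)

instance isFiniteMeasure_variation_component [IsFiniteMeasure μ.variation] :
    IsFiniteMeasure (component γ μ h).variation := by
  refine isFiniteMeasure_of_le (‖h‖₊ • μ.variation) ?_
  refine VectorMeasure.variation_le_of_forall_enorm_le fun s _ => ?_
  rw [Measure.smul_apply, component_apply]
  refine le_trans ?_ (mul_le_mul_right (VectorMeasure.enorm_measure_le_variation μ s) _)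
  rw [enorm_eq_nnnorm, enorm_eq_nnnorm]
  exact_mod_cast nnnorm_inner_le_nnnorm (𝕜 := ℝ) h (μ s)

lemma isBoundedlyContinuous_integral_component [IsFiniteMeasure μ.variation] :
    IsBoundedlyContinuous fun φ => ∫ᵛ x, φ x ∂•(component γ μ h) := by
  intro F f C hF hC hlim
  exact VectorMeasure.tendsto_integral_filter_of_norm_le_const
    (Eventually.of_forall fun n => (hF n).aestronglyMeasurable)
    ⟨C, Eventually.of_forall fun n => ae_of_all _ (hC n)⟩ (ae_of_all _ hlim)

end Component

section BV

variable {b : HilbertBasis ℕ ℝ (CameronMartin γ)}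

/-- Gaussian integration by parts is used along directions coming from `X*`; this is why the test
fields take values in the algebraic span of the basis. -/
lemma exists_toLp_eq_of_mem_span (hb : BasisInDual γ b) {e : CameronMartin γ}
    (he : e ∈ Submodule.span ℝ (Set.range b)) :
    ∃ L : StrongDual ℝ X, StrongDual.toLp γ 2 L = (e : Lp ℝ 2 γ) := by
  induction he using Submodule.span_induction with
  | mem x hx =>
    obtain ⟨j, rfl⟩ := hx
    exact hb j
  | zero => exact ⟨0, by simp⟩
  | add x y _ _ hx hy =>
    obtain ⟨L, hL⟩ := hx
    obtain ⟨M, hM⟩ := hy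
    exact ⟨L + M, by rw [map_add, hL, hM]; rfl⟩
  | smul c x _ hx =>
    obtain ⟨L, hL⟩ := hx
    exact ⟨c • L, by rw [map_smul, hL]; rfl⟩

lemma IsBVWithGradient.isFiniteMeasure {u : X → ℝ} {Du : VectorMeasure X (CameronMartin γ)}
    (hu : IsBVWithGradient γ b u Du) : IsFiniteMeasure Du.variation :=
  ⟨hu.variation_lt_top⟩

variable [CompleteSpace X] [SecondCountableTopology X]

/-- A `BV` function has a weak derivative along all finite combinations of the basis vectors. -/
lemma IsBVWithGradient.isDualPair [IsGaussian γ] {u : X → ℝ}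
    {Du : VectorMeasure X (CameronMartin γ)} (hu : IsBVWithGradient γ b u Du)
    {e : CameronMartin γ} (he : e ∈ Submodule.span ℝ (Set.range b)) :
    IsDualPair γ e u fun φ => ∫ᵛ x, φ x ∂•(component γ Du e) := by
  have := hu.isFiniteMeasure
  refine ⟨hu.memLp, fun φ hφ => ?_, isBoundedlyContinuous_integral_component _ _⟩
  have hφ' := hφ.isC1b
  obtain ⟨C, hC⟩ := hφ'.bounded
  have hint : ∀ k, Integrable (fun x => u x * adjointDeriv γ k φ x) γ := fun k =>
    hu.memLp.integrable_mul (hφ'.memLp_adjointDeriv k)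
  have hvint : ∀ k, VectorMeasure.Integrable (component γ Du k) φ := fun k =>
    Integrable.of_bound hφ'.contDiff.continuous.aestronglyMeasurable C (ae_of_all _ hC)
  induction he using Submodule.span_induction with
  | mem x hx =>
    obtain ⟨j, rfl⟩ := hx
    exact hu.integral_by_parts φ hφ j
  | zero =>
    have h0 : component γ Du 0 = 0 := by ext; simp [component_apply]
    rw [h0, VectorMeasure.integral_zero_vectorMeasure, neg_zero]
    have he : embed γ 0 = 0 := (embedLinear γ).map_zero
    simp [adjointDeriv, hφ'.partialDeriv_eq, he]
  | add x y _ _ hx hy =>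
    rw [component_add, VectorMeasure.integral_add_vectorMeasure (hvint x) (hvint y), neg_add,
      ← hx, ← hy, ← integral_add (hint x) (hint y)]
    refine integral_congr_ae ?_
    filter_upwards [Lp.coeFn_add (x : Lp ℝ 2 γ) y] with z hz
    simp only [adjointDeriv, hφ'.partialDeriv_eq, embed_add, map_add, Submodule.coe_add, hz,
      Pi.add_apply]
    ring
  | smul c x _ hx =>
    rw [component_smul, VectorMeasure.integral_smul_vectorMeasure, smul_eq_mul, ← mul_neg, ← hx,
      ← integral_const_mul]
    refine integral_congr_ae ?_
    filter_upwards [Lp.coeFn_smul c (x : Lp ℝ 2 γ)] with z hz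
    simp only [adjointDeriv, hφ'.partialDeriv_eq, embed_smul, map_smul, Submodule.coe_smul, hz,
      Pi.smul_apply, smul_eq_mul]
    ring

/-- Take `e = -y / ‖y‖` with `y` in the dense span and `‖z - y‖ < ε / 2`; this distance enters the
estimate twice. If `y = 0`, the convention `0⁻¹ = 0` gives `e = 0`, which still works. -/
lemma _root_.HilbertBasis.exists_mem_span_inner_le {H ι : Type*} [NormedAddCommGroup H]
    [InnerProductSpace ℝ H] (b : HilbertBasis ι ℝ H) (z : H) {ε : ℝ} (hε : 0 < ε) :
    ∃ e ∈ Submodule.span ℝ (Set.range b), ‖e‖ ≤ 1 ∧ inner ℝ e z ≤ -‖z‖ + ε := by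
  have hz : z ∈ closure (Submodule.span ℝ (Set.range b) : Set H) := by
    rw [← Submodule.topologicalClosure_coe, b.dense_span]
    trivial
  obtain ⟨y, hy, hyz⟩ := Metric.mem_closure_iff.1 hz (ε / 2) (by positivity)
  rw [dist_eq_norm] at hyz
  have hn : ‖-(‖y‖⁻¹ • y)‖ ≤ 1 := by
    rw [norm_neg, norm_smul, norm_inv, norm_norm]
    exact inv_mul_le_one
  refine ⟨-(‖y‖⁻¹ • y), Submodule.neg_mem _ (Submodule.smul_mem _ _ hy), hn, ?_⟩
  have h1 : inner ℝ (-(‖y‖⁻¹ • y)) y = -‖y‖ := by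
    rw [inner_neg_left, real_inner_smul_left, real_inner_self_eq_norm_sq]
    rcases eq_or_ne ‖y‖ 0 with h0 | h0
    · simp [h0]
    · field_simp
  have h2 : inner ℝ (-(‖y‖⁻¹ • y)) (z - y) ≤ ‖z - y‖ :=
    (real_inner_le_norm _ _).trans (mul_le_of_le_one_left (norm_nonneg _) hn)
  have h3 : inner ℝ (-(‖y‖⁻¹ • y)) z
      = inner ℝ (-(‖y‖⁻¹ • y)) y + inner ℝ (-(‖y‖⁻¹ • y)) (z - y) := by
    rw [← inner_add_right, add_sub_cancel]
  have h4 : ‖z‖ - ‖y‖ ≤ ‖z - y‖ := norm_sub_norm_le z y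
  linarith

/-- The total variation of an open set is almost attained on fields with finitely many values,
smoothed by Lipschitz cutoffs. -/
lemma exists_bumps (Du : VectorMeasure X (CameronMartin γ)) [IsFiniteMeasure Du.variation]
    (b : HilbertBasis ℕ ℝ (CameronMartin γ)) {Ω : Set X} (hΩ : IsOpen Ω) {a : ℝ≥0∞}
    (ha : a < Du.variation Ω) :
    ∃ (P : Finset (Set X)) (n : ℕ) (K : Set X → Set X) (e : Set X → CameronMartin γ),
      (∀ p ∈ P, e p ∈ Submodule.span ℝ (Set.range b)) ∧ (∀ p ∈ P, ‖e p‖ ≤ 1) ∧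
      (∀ p ∈ P, ∀ x, bump (K p) n x * bump Ωᶜ n x = 0) ∧
      (∀ x, ∑ p ∈ P, bump (K p) n x ≤ 1) ∧
      a < ENNReal.ofReal (-∑ p ∈ P, ∫ᵛ x, bump (K p) n x ∂•(component γ Du (e p))) := by
  obtain ⟨P, hPΩ, hPd, hPm, haP⟩ :=
    VectorMeasure.exists_lt_sum_of_lt_variation Du hΩ.measurableSet ha
  replace haP : a < ENNReal.ofReal (∑ p ∈ P, ‖Du p‖) := by
    refine haP.trans_eq ?_
    rw [ENNReal.ofReal_sum_of_nonneg fun _ _ => norm_nonneg _]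
    exact Finset.sum_congr rfl fun p _ => (ofReal_norm _).symm
  have hatop : a ≠ ∞ := ha.ne_top
  rw [ENNReal.lt_ofReal_iff_toReal_lt hatop] at haP
  set S := ∑ p ∈ P, ‖Du p‖ with hS
  set c := a.toReal
  -- Each piece loses `ε` by shrinking to a compact set and `ε` by the choice of direction; the `+
  -- 1` covers empty `P`.
  set ε := (S - c) / (2 * (P.card + 1)) with hε
  have hε0 : 0 < ε := div_pos (by linarith) (by positivity)
  have hεS : P.card * (2 * ε) < S - c := by
    have : (P.card + 1) * (2 * ε) = S - c := by
      rw [hε]; field_simp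
    nlinarith
  have hK : ∀ p : Set X, ∃ K, p ∈ P → K ⊆ p ∧ IsCompact K ∧ ‖Du p - Du K‖ ≤ ε := by
    intro p
    by_cases hp : p ∈ P
    · obtain ⟨K, hKp, hKc, hKε⟩ := (hPm p hp).exists_isCompact_sdiff_lt
        (μ := Du.variation) (measure_ne_top _ _) (ε := ENNReal.ofReal ε) (by simpa using hε0)
      refine ⟨K, fun _ => ⟨hKp, hKc, ?_⟩⟩
      rw [← VectorMeasure.of_sdiff hKc.measurableSet (hPm p hp) hKp]
      have h := (VectorMeasure.enorm_measure_le_variation Du (p \ K)).trans hKε.le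
      rw [← ofReal_norm] at h
      exact (ENNReal.ofReal_le_ofReal_iff hε0.le).1 h
    · exact ⟨∅, fun h => absurd h hp⟩
  choose K hK using hK
  -- The directions nearly oppose `Du (K p)`, which compensates the minus sign in the integration by
  -- parts.
  choose e he1 he2 he3 using fun p : Set X => b.exists_mem_span_inner_le (Du (K p)) hε0
  have hlim : Tendsto (fun n => ∑ p ∈ P, ∫ᵛ x, bump (K p) n x ∂•(component γ Du (e p))) atTop
      (𝓝 (∑ p ∈ P, inner ℝ (e p) (Du (K p)))) := by
    refine tendsto_finsetSum _ fun p hp => ?_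
    obtain ⟨-, hKc, -⟩ := hK p hp
    have h := isBoundedlyContinuous_integral_component Du (e p) (fun n => bump (K p) n) _ 1
      (fun n => (continuous_bump _ n).measurable) (fun n x => abs_bump_le_one _ n x)
      (fun x => tendsto_bump hKc.isClosed x)
    simp only [VectorMeasure.integral_indicator_const (1 : ℝ) hKc.measurableSet] at h
    simpa [component_apply] using h
  have hlt : ∑ p ∈ P, inner ℝ (e p) (Du (K p)) < -c := by
    have h1 : ∑ p ∈ P, inner ℝ (e p) (Du (K p)) ≤ ∑ p ∈ P, (-‖Du p‖ + 2 * ε) := by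
      refine Finset.sum_le_sum fun p hp => ?_
      have h2 := he3 p
      have h3 := (norm_sub_norm_le (Du p) (Du (K p))).trans (hK p hp).2.2
      linarith
    rw [Finset.sum_add_distrib, Finset.sum_neg_distrib, Finset.sum_const, nsmul_eq_mul, ← hS] at h1
    linarith
  have ev1 : ∀ᶠ n in atTop, ∑ p ∈ P, ∫ᵛ x, bump (K p) n x ∂•(component γ Du (e p)) < -c :=
    hlim.eventually (gt_mem_nhds hlt)
  have ev2 : ∀ᶠ n in atTop, ∀ p ∈ P, ∀ x, bump (K p) n x * bump Ωᶜ n x = 0 := by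
    rw [Filter.eventually_all_finset]
    exact fun p hp => eventually_bump_mul_bump (hK p hp).2.1 hΩ.isClosed_compl
      (Set.disjoint_compl_right_iff_subset.2 ((hK p hp).1.trans (hPΩ p hp)))
  have ev3 : ∀ᶠ n in atTop, ∀ p ∈ P, ∀ q ∈ P, p ≠ q →
      ∀ x, bump (K p) n x * bump (K q) n x = 0 := by
    rw [Filter.eventually_all_finset]
    intro p hp
    rw [Filter.eventually_all_finset]
    intro q hq
    rw [Filter.eventually_imp_distrib_left]
    exact fun hpq => eventually_bump_mul_bump (hK p hp).2.1 (hK q hq).2.1.isClosed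
      ((hPd hp hq hpq).mono (hK p hp).1 (hK q hq).1)
  obtain ⟨n, h1, h2, h3⟩ := (ev1.and (ev2.and ev3)).exists
  refine ⟨P, n, K, e, fun p _ => he1 p, fun p _ => he2 p, h2, fun x => ?_, ?_⟩
  · by_cases hx : ∃ p ∈ P, bump (K p) n x ≠ 0
    · obtain ⟨p, hp, hpx⟩ := hx
      rw [Finset.sum_eq_single_of_mem p hp fun q hq hqp =>
        (mul_eq_zero.1 (h3 q hq p hp hqp x)).resolve_right hpx]
      exact bump_le_one _ _ _
    · push Not at hx
      rw [Finset.sum_eq_zero hx]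
      exact zero_le_one
  · rw [ENNReal.lt_ofReal_iff_toReal_lt hatop]
    linarith

end BV

end TestFields

/-! ### Test fields for `BV` functions and passage to the limit. -/

section LowerSemicontinuity

/-- By Hölder, `L²` convergence of `v n` gives `L¹` convergence of `v n * g`. -/
lemma tendsto_integral_mul_of_tendsto_eLpNorm {Y : Type*} [MeasurableSpace Y] {μ : Measure Y}
    {v : ℕ → Y → ℝ} {u g : Y → ℝ}
    (hv : ∀ n, MemLp (v n) 2 μ) (hu : MemLp u 2 μ) (hg : MemLp g 2 μ)
    (h : Tendsto (fun n => eLpNorm (v n - u) 2 μ) atTop (𝓝 0)) :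
    Tendsto (fun n => ∫ x, v n x * g x ∂μ) atTop (𝓝 (∫ x, u x * g x ∂μ)) := by
  refine tendsto_integral_of_L1' _ (hu.integrable_mul hg).1
    (Eventually.of_forall fun n => (hv n).integrable_mul hg) ?_
  have hlim : Tendsto (fun n => eLpNorm (v n - u) 2 μ * eLpNorm g 2 μ) atTop (𝓝 0) := by
    simpa using ENNReal.Tendsto.mul_const h (Or.inr hg.eLpNorm_ne_top)
  refine tendsto_of_tendsto_of_tendsto_of_le_of_le tendsto_const_nhds hlim (fun n => zero_le)
    fun n => ?_
  have hle := eLpNorm_smul_le_mul_eLpNorm (p := 2) (q := 2) (r := 1) hg.1 ((hv n).sub hu).1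
  refine le_trans (le_of_eq ?_) hle
  congr 1
  ext x
  simp [sub_mul]

variable {X : Type*} [NormedAddCommGroup X] [NormedSpace ℝ X] [MeasurableSpace X] [BorelSpace X]
  [CompleteSpace X] [SecondCountableTopology X] {γ : Measure X}
  {b : HilbertBasis ℕ ℝ (CameronMartin γ)}

/-- For a `BV` function `u` there are admissible test fields whose divergence is supported in `Ω`
and which almost realise the total variation of `u` in `Ω`; the same fields bound the total
variation of any `BV` function from below. -/
lemma exists_test_field (hγ : IsCentredNondegenerateGaussian γ) (hb : BasisInDual γ b)
    {u : X → ℝ} {Du : VectorMeasure X (CameronMartin γ)} (hu : IsBVWithGradient γ b u Du)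
    {Ω : Set X} (hΩ : IsOpen Ω) {a : ℝ≥0∞} (ha : a < Du.variation Ω) :
    ∃ (φ : X → CameronMartin γ) (g : X → ℝ), IsLip0 γ Ω φ ∧ (∀ x, ‖φ x‖ ≤ 1) ∧
      IsDivergence γ φ g ∧ (∀ᵐ x ∂γ, x ∉ Ω → g x = 0) ∧
      a < ENNReal.ofReal (∫ x, u x * g x ∂γ) ∧
      ∀ v Dv, IsBVWithGradient γ b v Dv →
        ENNReal.ofReal (∫ x, v x * g x ∂γ) ≤ Dv.variation Ω := by
  have := hγ.isGaussian
  have := hu.isFiniteMeasure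
  obtain ⟨P, n, K, e, he, he1, hKΩ, hsum, hlt⟩ := exists_bumps Du b hΩ ha
  choose g hg using fun p : Set X =>
    exists_isWeakDivergence (e p) (exists_lipschitzWith_bump (K p) n).choose_spec
      (abs_bump_le_one (K p) n)
  have hoff : ∀ p ∈ P, ∀ x, x ∉ Ω → bump (K p) n x = 0 := fun p hp x hx => by
    simpa [bump_eq_one Ωᶜ n hx] using hKΩ p hp x
  have hint : ∀ w, MemLp w 2 γ → ∫ x, w x * ∑ p ∈ P, g p x ∂γ = ∑ p ∈ P, ∫ x, w x * g p x ∂γ := by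
    intro w hw
    simp_rw [Finset.mul_sum]
    exact integral_finsetSum _ fun p _ => hw.integrable_mul (hg p).memLp
  have hBV : ∀ v Dv, IsBVWithGradient γ b v Dv → ∫ x, v x * ∑ p ∈ P, g p x ∂γ
      = -∑ p ∈ P, ∫ᵛ x, bump (K p) n x ∂•(component γ Dv (e p)) := fun v Dv hv => by
    rw [hint v hv.memLp, ← Finset.sum_neg_distrib]
    exact Finset.sum_congr rfl fun p hp => (hg p).integral_mul _ _ (hv.isDualPair (he p hp))
  refine ⟨fun x => ∑ p ∈ P, bump (K p) n x • e p, fun x => ∑ p ∈ P, g p x, ⟨?_, fun x hx => ?_⟩,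
    fun x => ?_, ⟨memLp_finsetSum _ fun p _ => (hg p).memLp, fun f hf => ?_⟩, ?_, ?_,
    fun v Dv hv => ?_⟩
  · have : ∀ Q : Finset (Set X), ∃ C : ℝ≥0,
        LipschitzWith C fun x => ∑ p ∈ Q, bump (K p) n x • e p := by
      classical
      intro Q
      induction Q using Finset.induction_on with
      | empty => exact ⟨0, by simp⟩
      | insert p Q hp ih =>
        obtain ⟨C, hC⟩ := ih
        obtain ⟨D, hD⟩ := exists_lipschitzWith_bump (K p) n
        have hDe : LipschitzWith (‖e p‖₊ * D) fun x => bump (K p) n x • e p :=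
          LipschitzWith.of_dist_le_mul fun x y => by
            rw [dist_eq_norm, ← sub_smul, norm_smul, ← dist_eq_norm, NNReal.coe_mul, coe_nnnorm,
              mul_comm, mul_assoc]
            exact mul_le_mul_of_nonneg_left (hD.dist_le_mul x y) (norm_nonneg _)
        simp_rw [Finset.sum_insert hp]
        exact ⟨_, hDe.add hC⟩
    exact this P
  · exact Finset.sum_eq_zero fun p hp => by rw [hoff p hp x hx, zero_smul]
  · refine (norm_sum_le _ _).trans (le_trans (Finset.sum_le_sum fun p hp => ?_) (hsum x))
    rw [norm_smul, Real.norm_of_nonneg (bump_nonneg _ _ _)]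
    exact mul_le_of_le_one_right (bump_nonneg _ _ _) (he1 p hp)
  · have hf' := hf.isC1b
    obtain ⟨C, hC⟩ := hf'.bounded
    have hfm : MemLp f 2 γ :=
      MemLp.of_bound hf'.contDiff.continuous.aestronglyMeasurable C (ae_of_all _ hC)
    have hpair : ∀ p ∈ P, ∫ x, f x * g p x ∂γ
        = -∫ x, bump (K p) n x * partialDeriv γ (e p) f x ∂γ := fun p hp => by
      obtain ⟨L, hL⟩ := exists_toLp_eq_of_mem_span hb (he p hp)
      exact (hg p).integral_mul _ _ (isDualPair_of_isCylindricalC1b hγ hL hf)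
    rw [hint f hfm, Finset.sum_congr rfl hpair, Finset.sum_neg_distrib, ← integral_finsetSum]
    · congr 2
      ext x
      rw [hf'.partialDeriv_eq]
      change _ = fderiv ℝ f x (embedLinear γ _)
      rw [map_sum, map_sum]
      refine Finset.sum_congr rfl fun p _ => ?_
      rw [map_smul, map_smul, hf'.partialDeriv_eq]
      rfl
    · intro p _
      obtain ⟨D, hD⟩ := hf'.exists_bound_partialDeriv (e p)
      exact integrable_continuous_mul (continuous_bump _ _) (abs_bump_le_one _ _)
        (Integrable.of_bound (hf'.continuous_partialDeriv (e p)).aestronglyMeasurable D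
          (ae_of_all _ hD))
  -- Locality with the cutoff `bump Ωᶜ n`, which equals 1 off `Ω` and has zero product with each
  -- bump of the field.
  · have hloc : ∀ p ∈ P, ∀ᵐ x ∂γ, bump Ωᶜ n x = 1 → g p x = 0 := fun p hp => by
      obtain ⟨L, hL⟩ := exists_toLp_eq_of_mem_span hb (he p hp)
      exact (hg p).ae_eq_zero hγ hL (continuous_bump _ _) (abs_bump_le_one _ _)
        (exists_lipschitzWith_bump Ωᶜ n).choose_spec (abs_bump_le_one _ _) (hKΩ p hp)
    filter_upwards [(Finset.eventually_all P).2 hloc] with x hx hxΩ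
    exact Finset.sum_eq_zero fun p hp => hx p hp (bump_eq_one Ωᶜ n hxΩ)
  · rwa [hBV u Du hu]
  · rw [hBV v Dv hv, ← Finset.sum_neg_distrib]
    -- The component measures have variation at most `Dv.variation`, and the bumps sum to at most
    -- the indicator of `Ω`.
    have hp : ∀ p ∈ P, ‖-∫ᵛ x, bump (K p) n x ∂•(component γ Dv (e p))‖ₑ
        ≤ ∫⁻ x, ‖bump (K p) n x‖ₑ ∂Dv.variation := fun p hp => by
      rw [enorm_neg]
      refine (VectorMeasure.enorm_integral_le_lintegral_enorm_transpose).trans ?_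
      rw [VectorMeasure.variation_transpose_lsmul]
      exact lintegral_mono' (variation_component_le _ _ (he1 p hp)) le_rfl
    calc ENNReal.ofReal (∑ p ∈ P, -∫ᵛ x, bump (K p) n x ∂•(component γ Dv (e p)))
        ≤ ‖∑ p ∈ P, -∫ᵛ x, bump (K p) n x ∂•(component γ Dv (e p))‖ₑ :=
          Real.ofReal_le_enorm _
      _ ≤ ∑ p ∈ P, ‖-∫ᵛ x, bump (K p) n x ∂•(component γ Dv (e p))‖ₑ := enorm_sum_le _ _
      _ ≤ ∑ p ∈ P, ∫⁻ x, ‖bump (K p) n x‖ₑ ∂Dv.variation := Finset.sum_le_sum hp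
      _ = ∫⁻ x, ∑ p ∈ P, ‖bump (K p) n x‖ₑ ∂Dv.variation :=
          (lintegral_finsetSum _ fun p _ => (continuous_bump _ _).enorm.measurable).symm
      _ ≤ ∫⁻ x, Ω.indicator 1 x ∂Dv.variation := by
          refine lintegral_mono fun x => ?_
          by_cases hx : x ∈ Ω
          · rw [Set.indicator_of_mem hx, Pi.one_apply]
            simp_rw [Real.enorm_of_nonneg (bump_nonneg _ _ _)]
            rw [← ENNReal.ofReal_sum_of_nonneg fun p _ => bump_nonneg _ _ _]
            exact ENNReal.ofReal_le_one.2 (hsum x)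
          · rw [Finset.sum_eq_zero fun p hp => by rw [hoff p hp x hx, enorm_zero]]
            exact zero_le
      _ = Dv.variation Ω := lintegral_indicator_one hΩ.measurableSet

/-- Lower semicontinuity of the total variation of `u` in `Ω`, with respect to any functional `V`
that dominates the test fields with divergence supported in `Ω`. -/
lemma variation_le_liminf (hγ : IsCentredNondegenerateGaussian γ) (hb : BasisInDual γ b)
    {u : X → ℝ} {Du : VectorMeasure X (CameronMartin γ)} (hu : IsBVWithGradient γ b u Du)
    {Ω : Set X} (hΩ : IsOpen Ω) {v : ℕ → X → ℝ} (hv : ∀ n, MemLp (v n) 2 (γ.restrict Ω))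
    (hlim : Tendsto (fun n => eLpNorm (v n - u) 2 (γ.restrict Ω)) atTop (𝓝 0)) {V : ℕ → ℝ≥0∞}
    (hV : ∀ n φ g, IsLip0 γ Ω φ → (∀ x, ‖φ x‖ ≤ 1) → IsDivergence γ φ g →
      (∀ᵐ x ∂γ, x ∉ Ω → g x = 0) →
      (∀ w Dw, IsBVWithGradient γ b w Dw →
        ENNReal.ofReal (∫ x, w x * g x ∂γ) ≤ Dw.variation Ω) →
      ENNReal.ofReal (∫ x in Ω, v n x * g x ∂γ) ≤ V n) :
    Du.variation Ω ≤ liminf V atTop := by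
  refine le_of_forall_lt fun a ha => ?_
  -- The intermediate `c` keeps the inequality strict: the liminf only inherits a non-strict bound.
  obtain ⟨c, hac, hc⟩ := exists_between ha
  obtain ⟨φ, g, h1, h2, h3, h4, h5, h6⟩ := exists_test_field hγ hb hu hΩ hc
  have hset : ∫ x in Ω, u x * g x ∂γ = ∫ x, u x * g x ∂γ := by
    refine setIntegral_eq_integral_of_ae_compl_eq_zero ?_
    filter_upwards [h4] with x hx hxΩ
    rw [hx hxΩ, mul_zero]
  have ht := ENNReal.tendsto_ofReal (tendsto_integral_mul_of_tendsto_eLpNorm hv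
    (hu.memLp.restrict Ω) (h3.1.restrict Ω) hlim)
  rw [hset] at ht
  refine hac.trans_le (le_liminf_of_le (by isBoundedDefault) ?_)
  filter_upwards [ht.eventually (lt_mem_nhds h5)] with n hn
  exact hn.le.trans (hV n φ g h1 h2 h3 h4 h6)

end LowerSemicontinuity

end WienerBV

theorem corollary2p4 {X : Type*} [NormedAddCommGroup X] [NormedSpace ℝ X] [CompleteSpace X]
    [TopologicalSpace.SeparableSpace X] [MeasurableSpace X] [BorelSpace X]
    (γ : Measure X) (hγ : WienerBV.IsCentredNondegenerateGaussian γ)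
    (b : HilbertBasis ℕ ℝ (WienerBV.CameronMartin γ)) (hb : WienerBV.BasisInDual γ b)
    (u : X → ℝ) (Du : VectorMeasure X (WienerBV.CameronMartin γ))
    (hu : WienerBV.IsBVWithGradient γ b u Du)
    (Ω : Set X) (hΩ : IsOpen Ω) (huΩ : MemLp u 2 (γ.restrict Ω)) :
    (∀ (v : ℕ → X → ℝ) (Dv : ℕ → VectorMeasure X (WienerBV.CameronMartin γ)),
      (∀ n, WienerBV.IsBVWithGradient γ b (v n) (Dv n)) →
      Tendsto (fun n => eLpNorm (v n - u) 2 (γ.restrict Ω)) atTop (𝓝 0) →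
      Du.variation Ω ≤ liminf (fun n => (Dv n).variation Ω) atTop) ∧
    (∀ v : ℕ → X → ℝ, (∀ n, MemLp (v n) 2 (γ.restrict Ω)) →
      Tendsto (fun n => eLpNorm (v n - u) 2 (γ.restrict Ω)) atTop (𝓝 0) →
      Du.variation Ω ≤ liminf (fun n => WienerBV.variationOn γ Ω (v n)) atTop) := by
  have := UniformSpace.secondCountable_of_separable X
  refine ⟨fun v Dv hv hlim => ?_, fun v hv hlim => ?_⟩
  · refine WienerBV.variation_le_liminf hγ hb hu hΩ (fun n => (hv n).memLp.restrict Ω) hlim ?_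
    intro n φ g _ _ _ h4 h6
    -- Integration by parts for `v n` concerns all of `X`; locality of `g` identifies that integral
    -- with the one over `Ω`.
    have hset : ∫ x in Ω, v n x * g x ∂γ = ∫ x, v n x * g x ∂γ := by
      refine setIntegral_eq_integral_of_ae_compl_eq_zero ?_
      filter_upwards [h4] with x hx hxΩ
      rw [hx hxΩ, mul_zero]
    rw [hset]
    exact h6 _ _ (hv n)
  · refine WienerBV.variation_le_liminf hγ hb hu hΩ hv hlim ?_
    intro n φ g h1 h2 h3 _ _
    -- The test field is itself a competitor in the supremum, so `v n` is needed only on `Ω`.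
    exact le_iSup_of_le φ <| le_iSup_of_le g <| le_iSup_of_le h1 <| le_iSup_of_le h2 <|
      le_iSup_of_le h3 le_rfl
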